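/- Let $k$ be a field and let $A$ and $B$ be finite dimensional (associative, unital) $k$-algebras with $A\neq 0$; put $\Lambda=A\otimes_k B$. Unless said otherwise, modules are finitely generated left modules, and $D=\operatorname{Hom}_k(-,k)$. For a finite dimensional $k$-algebra $\Gamma$, a $\Gamma$-module $G$ is Gorenstein projective if there is an exact complex $\cdots\to P^{i}\xrightarrow{d^i}P^{i+1}\to\cdots$ $(i\in\mathbb Z)$ of finitely generated projective $\Gamma$-modules such that $\operatorname{Hom}_\Gamma(P^\bullet,\Gamma)$ is again exact and $G\cong\operatorname{Ker} d^1$; $\Gamma\text{-Gproj}$ denotes the full subcategory of the Gorenstein projective $\Gamma$-modules. The algebra $\Gamma$ is Gorenstein if $\Gamma$ has finite injective dimension both as a left and as a right module over itself, and CM-free if $\Gamma\text{-Gproj}$ is the category of all finitely generated projective $\Gamma$-modules, i.e. every Gorenstein projective $\Gamma$-module is projective. Let $\operatorname{Mon}(B,A)$ be the full subcategory of the $\Lambda$-modules $X$ with $\operatorname{Tor}^{\Lambda}_i(A\otimes_k D(S),X)=0$ for all $i\ge 1$ and all simple left $B$-modules $S$, and let $\operatorname{Mon}(B,A\text{-Gproj})$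 be the full subcategory of the $X\in\operatorname{Mon}(B,A)$ such that the left $A$-module $(A\otimes_k V)\otimes_\Lambda X$ lies in $A\text{-Gproj}$ for every finitely generated right $B$-module $V$. **Theorem.** Suppose that $A$ is Gorenstein. Then $\Lambda\text{-Gproj}=\operatorname{Mon}(B,A\text{-Gproj})$ if and only if $B$ is CM-free. -/

import Mathlib

open CategoryTheory
open scoped TensorProduct

universe u

noncomputable section

namespace MonGorenstein

/-! ### Tensor product and Tor over a not necessarily commutative ring

Right modules over a ring `Γ` are modules over `Γᵐᵒᵖ`. -/

section BalancedTensor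

set_option linter.unusedSectionVars false

variable (R Γ : Type u) [Ring R] [Ring Γ]
variable (M : Type u) [AddCommGroup M] [Module R M] [Module Γᵐᵒᵖ M] [SMulCommClass R Γᵐᵒᵖ M]

/-- For an `R`-`Γ`-bimodule `M` and a left `Γ`-module `X`, the relations
`m γ ⊗ x = m ⊗ γ x` in `M ⊗[ℤ] X`. As the set of relations is stable under `R`, its `R`-span
is the additive subgroup that it generates. -/
def balancedRel (X : Type u) [AddCommGroup X] [Module Γ X] : Submodule R (M ⊗[ℤ] X) :=
  Submodule.span R
    {z | ∃ (m : M) (γ : Γ) (x : X), z = (MulOpposite.op γ • m) ⊗ₜ[ℤ] x - m ⊗ₜ[ℤ] (γ • x)}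

/-- The left `R`-module `M ⊗_Γ X`, for an `R`-`Γ`-bimodule `M` and a left `Γ`-module `X`. -/
abbrev BalancedTensor (X : Type u) [AddCommGroup X] [Module Γ X] : Type u :=
  (M ⊗[ℤ] X) ⧸ balancedRel R Γ M X

variable {X Y Z : Type u} [AddCommGroup X] [Module Γ X] [AddCommGroup Y] [Module Γ Y]
  [AddCommGroup Z] [Module Γ Z]

/-- The `R`-linear map `M ⊗[ℤ] X → M ⊗[ℤ] Y`, `m ⊗ x ↦ m ⊗ f x`. -/
def intTensorMap (f : X →ₗ[Γ] Y) : M ⊗[ℤ] X →ₗ[R] M ⊗[ℤ] Y :=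
  TensorProduct.AlgebraTensorModule.map (LinearMap.id : M →ₗ[R] M)
    f.toAddMonoidHom.toIntLinearMap

lemma intTensorMap_tmul (f : X →ₗ[Γ] Y) (m : M) (x : X) :
    intTensorMap R Γ M f (m ⊗ₜ x) = m ⊗ₜ f x := rfl

lemma balancedRel_le_comap (f : X →ₗ[Γ] Y) :
    balancedRel R Γ M X ≤ (balancedRel R Γ M Y).comap (intTensorMap R Γ M f) := by
  refine Submodule.span_le.2 ?_
  rintro _ ⟨m, γ, x, rfl⟩
  refine Submodule.subset_span ⟨m, γ, f x, ?_⟩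
  simp [intTensorMap_tmul]

/-- The `R`-linear map `M ⊗_Γ X → M ⊗_Γ Y` induced by `f : X → Y`. -/
def BalancedTensor.map (f : X →ₗ[Γ] Y) : BalancedTensor R Γ M X →ₗ[R] BalancedTensor R Γ M Y :=
  Submodule.mapQ _ _ (intTensorMap R Γ M f) (balancedRel_le_comap R Γ M f)

/-- The functor `M ⊗_Γ -` from left `Γ`-modules to left `R`-modules. -/
def tensorFunctor : ModuleCat.{u} Γ ⥤ ModuleCat.{u} R where
  obj X := ModuleCat.of R (BalancedTensor R Γ M X)
  map f := ModuleCat.ofHom (BalancedTensor.map R Γ M f.hom)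
  map_id X := ModuleCat.hom_ext (by
    refine Submodule.linearMap_qext _ (TensorProduct.AlgebraTensorModule.ext fun m x => ?_)
    rfl)
  map_comp f g := ModuleCat.hom_ext (by
    refine Submodule.linearMap_qext _ (TensorProduct.AlgebraTensorModule.ext fun m x => ?_)
    rfl)

instance : (tensorFunctor R Γ M).Additive where
  map_add {X Y f g} := ModuleCat.hom_ext (by
    refine Submodule.linearMap_qext _ (TensorProduct.AlgebraTensorModule.ext fun m x => ?_)
    exact congrArg (Submodule.Quotient.mk (p := balancedRel R Γ M Y))
      (TensorProduct.tmul_add m (f.hom x) (g.hom x)))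

/-- `Tor_i^Γ(M, X)` (as a left `R`-module): the `i`-th left derived functor of `M ⊗_Γ -`. -/
def Tor (i : ℕ) (X : ModuleCat.{u} Γ) : ModuleCat.{u} R :=
  ((tensorFunctor R Γ M).leftDerived i).obj X

end BalancedTensor

/-! ### Gorenstein projective modules -/

section Gorenstein

variable (Γ : Type u) [Ring Γ]

/-- A complete projective resolution of `G`: an exact complex
`⋯ → P i → P (i + 1) → ⋯` of finitely generated projective left `Γ`-modules, which stays exact
under `Hom_Γ(-, Γ)`, together with an isomorphism of `G` with the kernel of `d 1`. -/
structure CompleteResolution (G : ModuleCat.{u} Γ) where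
  P : ℤ → ModuleCat.{u} Γ
  finite : ∀ i, Module.Finite Γ (P i)
  projective : ∀ i, Module.Projective Γ (P i)
  d : ∀ i, P i →ₗ[Γ] P (i + 1)
  exact : ∀ i, Function.Exact (d i) (d (i + 1))
  hom_exact : ∀ i, Function.Exact
    (fun f : P (i + 1 + 1) →ₗ[Γ] Γ => f ∘ₗ d (i + 1)) (fun f : P (i + 1) →ₗ[Γ] Γ => f ∘ₗ d i)
  iso : G ≃ₗ[Γ] LinearMap.ker (d 1)

/-- `Γ`-Gproj: the class of finitely generated Gorenstein projective left `Γ`-modules. -/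
def Gproj : ObjectProperty (ModuleCat.{u} Γ) :=
  fun G => Module.Finite Γ G ∧ Nonempty (CompleteResolution Γ G)

/-- The class of finitely generated projective left `Γ`-modules. -/
def Proj : ObjectProperty (ModuleCat.{u} Γ) :=
  fun G => Module.Finite Γ G ∧ Module.Projective Γ G

/-- `Γ` is CM-free: the finitely generated Gorenstein projective modules are exactly the
finitely generated projective modules. -/
def IsCMFree : Prop := Gproj Γ = Proj Γ

/-- `Γ` is Gorenstein: it has finite injective dimension as a left and as a right module over
itself. -/
def IsGorenstein : Prop :=
  (∃ n : ℕ, HasInjectiveDimensionLE (ModuleCat.of Γ Γ) n) ∧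
    ∃ n : ℕ, HasInjectiveDimensionLE (ModuleCat.of Γᵐᵒᵖ Γ) n

end Gorenstein

/-! ### The duality `D = Hom_k(-, k)` -/

section Dual

variable (k B S : Type u) [Field k] [Ring B] [Algebra k B]
  [AddCommGroup S] [Module k S] [Module B S] [IsScalarTower k B S]

/-- `D(S) = Hom_k(S, k)`, as a right `B`-module via `(f b)(s) = f (b s)`. -/
def D : Type u := Module.Dual k S

instance : AddCommGroup (D k S) := inferInstanceAs (AddCommGroup (S →ₗ[k] k))

instance : Module k (D k S) := inferInstanceAs (Module k (S →ₗ[k] k))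

instance : FunLike (D k S) S k := inferInstanceAs (FunLike (S →ₗ[k] k) S k)

variable {k B S} in
@[ext]
lemma D.ext {f g : D k S} (h : ∀ s, f s = g s) : f = g := LinearMap.ext h

instance : Module Bᵐᵒᵖ (D k S) where
  smul b f := LinearMap.comp (show S →ₗ[k] k from f) (Algebra.lsmul k k S b.unop)
  one_smul f := D.ext fun s => congrArg f (one_smul B s)
  mul_smul b c f := D.ext fun s => congrArg f (mul_smul c.unop b.unop s)
  smul_zero _ := rfl
  smul_add _ _ _ := rfl
  add_smul b c f := D.ext fun s => by
    exact (congrArg f (add_smul b.unop c.unop s)).trans (map_add (show S →ₗ[k] k from f) _ _)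
  zero_smul f := D.ext fun s => by
    exact (congrArg f (zero_smul B s)).trans (map_zero (show S →ₗ[k] k from f))

lemma D.op_smul_apply (b : B) (f : D k S) (s : S) : (MulOpposite.op b • f) s = f (b • s) := rfl

instance : IsScalarTower k Bᵐᵒᵖ (D k S) where
  smul_assoc c b f := D.ext fun s => by
    exact (congrArg f (smul_assoc c b.unop s)).trans (map_smul (show S →ₗ[k] k from f) c _)

end Dual

/-! ### The bimodule `A ⊗ V` and the monomorphism category -/

section Mon

variable (k A B : Type u) [Field k] [Ring A] [Algebra k A] [Ring B] [Algebra k B]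
variable (V : Type u) [AddCommGroup V] [Module k V] [Module Bᵐᵒᵖ V] [IsScalarTower k Bᵐᵒᵖ V]

/-- The right action of `A ⊗ B` on `A ⊗ V`, for a right `B`-module `V`:
`(a ⊗ v) (a' ⊗ b) = a a' ⊗ v b`. -/
def rightAction : (A ⊗[k] B)ᵐᵒᵖ →ₐ[k] Module.End k (A ⊗[k] V) :=
  ((Module.endTensorEndAlgHom (R := k) (S := k) (A := k) (M := A) (N := V)).comp
    (Algebra.TensorProduct.map (Algebra.lsmul k k A : Aᵐᵒᵖ →ₐ[k] Module.End k A)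
      (Algebra.lsmul k k V : Bᵐᵒᵖ →ₐ[k] Module.End k V))).comp
    (Algebra.TensorProduct.opAlgEquiv k k A B).symm.toAlgHom

instance : Module (A ⊗[k] B)ᵐᵒᵖ (A ⊗[k] V) :=
  Module.compHom (A ⊗[k] V) (rightAction k A B V).toRingHom

lemma op_tmul_smul_tmul (a a' : A) (b : B) (v : V) :
    MulOpposite.op (a' ⊗ₜ[k] b) • (a ⊗ₜ[k] v) = (a * a') ⊗ₜ[k] (MulOpposite.op b • v) := by
  change rightAction k A B V (MulOpposite.op (a' ⊗ₜ[k] b)) (a ⊗ₜ[k] v) = _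
  simp [rightAction, Algebra.TensorProduct.opAlgEquiv]
  rfl

instance : SMulCommClass A (A ⊗[k] B)ᵐᵒᵖ (A ⊗[k] V) where
  smul_comm a r z := by
    induction r using MulOpposite.rec' with | _ r => ?_
    induction z with
    | zero => simp
    | add z w hz hw => simp only [smul_add, hz, hw]
    | tmul a' v =>
      induction r with
      | zero => simp
      | add r s hr hs => simp only [MulOpposite.op_add, add_smul, smul_add, hr, hs]
      | tmul a'' b =>
        simp only [op_tmul_smul_tmul, TensorProduct.smul_tmul', smul_eq_mul, mul_assoc]

/-- `Mon(B, A)`: the finitely generated left modules `X` over `A ⊗ B` such that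
`Tor_i(A ⊗ D(S), X) = 0` for all `i ≥ 1` and all simple left `B`-modules `S`. -/
def Mon : ObjectProperty (ModuleCat.{u} (A ⊗[k] B)) := fun X =>
  Module.Finite (A ⊗[k] B) X ∧
    ∀ (S : Type u) [AddCommGroup S] [Module k S] [Module B S] [IsScalarTower k B S]
      [IsSimpleModule B S] (i : ℕ), 1 ≤ i →
      Limits.IsZero (Tor A (A ⊗[k] B) (A ⊗[k] D k S) i X)

/-- `Mon(B, L)`, for a class `L` of finitely generated left `A`-modules: the modules `X` in
`Mon(B, A)` such that the left `A`-module `(A ⊗ V) ⊗_{A ⊗ B} X` lies in `L` for all finitely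
generated right `B`-modules `V`. -/
def MonIn (L : ObjectProperty (ModuleCat.{u} A)) : ObjectProperty (ModuleCat.{u} (A ⊗[k] B)) :=
  fun X => Mon k A B X ∧
    ∀ (V : Type u) [AddCommGroup V] [Module k V] [Module Bᵐᵒᵖ V] [IsScalarTower k Bᵐᵒᵖ V]
      [Module.Finite Bᵐᵒᵖ V],
      L ((tensorFunctor A (A ⊗[k] B) (A ⊗[k] V)).obj X)

end Mon

end MonGorenstein

end

/-!
The proof replaces both sides of the comparison by descriptions that avoid complexes and `Tor`.

*The monomorphism category.* As a group, `(A ⊗ V) ⊗_{A ⊗ B} X` is `V ⊗_B X`. Hence the `Tor` in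
the definition of `Mon(B, A)` is `Tor^B(DS, X)`, whose dual is `Ext_B(X, S)`, and `Mon(B, A)`
consists of the finitely generated modules that are projective over `B` (`mon_iff`). For such modules all
functors `V ⊗_B -` and `- ⊗_B X` preserve the relevant short exact sequences (`IsSES.tens`,
`IsSES.tens_left`).

*Gorenstein projective modules.* They form the largest class of finitely generated modules in which
every module continues to the left and to the right by short exact sequences with finitely generated
projective middle term that stay exact under `Hom(-, Γ)` (`gproj_of_class`). The condition on
`Hom(-, Γ)` says that maps to `Γ` extend along the first map of the sequence, so it is recorded by
the predicate `Extends`. Since `A ⊗ B ≅ Hom_k(DB, A)`, maps `X → A ⊗ B` correspond to maps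
`DB ⊗_B X → A` (`extends_tens_iff`).

*`B` is CM-free.* Let `X` be Gorenstein projective over `A ⊗ B`. An injective coresolution of the
right module `A`, which is finite, gives a finite resolution of `Hom_k(A, B)` by projective
`A ⊗ B`-modules; so `X` is Ext-orthogonal to `Hom_k(A, B)`, and therefore `X` is Gorenstein
projective over `B` (`gproj_res`), hence projective over `B`. A complete resolution of `X` then
stays exact under `V ⊗_B -`, and the `A`-modules `V ⊗_B X` are Gorenstein projective because `A` has
finite injective dimension as a left module (`gproj_le_monIn`).

Conversely, let `X` be in `Mon(B, A-Gproj)`. Surjections from free modules continue `X` to the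
left within this class. To the right, take a left approximation `X → P` of `X` by a free module. By adjunction
`DB ⊗_B X → DB ⊗_B P` is a left approximation of a Gorenstein projective `A`-module, and the same
follows for `V ⊗_B X`, embedding `V` in a power of `DB`; so these maps are injective. Hence `X → P`
is a split monomorphism over `B`, and its cokernel is again in `Mon(B, A-Gproj)` (`monIn_le_gproj`).

*The converse.* Induction `G ↦ A ⊗ G` preserves Gorenstein projective modules (`gproj_ind`). If
`A ⊗ G` lies in `Mon(B, A)`, then it is projective over `B`, and `G` is a direct summand of it
because `A ≠ 0` (`projective_of_ind`).
-/

namespace MonGorenstein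

/-! ### Short exact sequences, extension of maps, and vanishing of Ext -/

section ShortExact

variable {Γ : Type u} [Ring Γ]
variable {X P Y L M N : Type u} [AddCommGroup X] [Module Γ X] [AddCommGroup P] [Module Γ P]
  [AddCommGroup Y] [Module Γ Y] [AddCommGroup L] [Module Γ L] [AddCommGroup M] [Module Γ M]
  [AddCommGroup N] [Module Γ N]

/-- The sequence `0 → X → P → Y → 0` is exact. -/
structure IsSES (ι : X →ₗ[Γ] P) (π : P →ₗ[Γ] Y) : Prop where
  inj : Function.Injective ι
  exact : Function.Exact ι π
  surj : Function.Surjective π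

/-- Every map `X → L` extends along `ι : X → P`, that is, `Hom(P, L) → Hom(X, L)` is
surjective. -/
def Extends (ι : X →ₗ[Γ] P) (L : Type u) [AddCommGroup L] [Module Γ L] : Prop :=
  ∀ g : X →ₗ[Γ] L, ∃ h : P →ₗ[Γ] L, ∀ x, h (ι x) = g x

lemma exists_factor_of_surjective {p : M →ₗ[Γ] N} (hp : Function.Surjective p) (f : M →ₗ[Γ] L)
    (h : ∀ m, p m = 0 → f m = 0) : ∃ g : N →ₗ[Γ] L, ∀ m, g (p m) = f m := by
  refine ⟨(LinearMap.ker p).liftQ f (fun m hm => h m hm) ∘ₗ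
    (p.quotKerEquivOfSurjective hp).symm.toLinearMap, fun m => ?_⟩
  have : (p.quotKerEquivOfSurjective hp).symm (p m) = (LinearMap.ker p).mkQ m := by
    rw [LinearEquiv.symm_apply_eq]; rfl
  rw [LinearMap.comp_apply, LinearEquiv.coe_coe, this]
  rfl

lemma exists_factor_of_injective {i : N →ₗ[Γ] M} (hi : Function.Injective i) (f : L →ₗ[Γ] M)
    (h : ∀ l, ∃ n, i n = f l) : ∃ g : L →ₗ[Γ] N, ∀ l, i (g l) = f l := by
  refine ⟨(LinearEquiv.ofInjective i hi).symm.toLinearMap ∘ₗ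
    f.codRestrict (LinearMap.range i) h, fun l => ?_⟩
  exact congrArg Subtype.val ((LinearEquiv.ofInjective i hi).apply_symm_apply
    (f.codRestrict (LinearMap.range i) h l))

namespace IsSES

variable {ι : X →ₗ[Γ] P} {π : P →ₗ[Γ] Y}

lemma comp_apply (h : IsSES ι π) (x : X) : π (ι x) = 0 := h.exact.apply_apply_eq_zero x

lemma exists_of_eq_zero (h : IsSES ι π) {p : P} (hp : π p = 0) : ∃ x, ι x = p := (h.exact p).1 hp

lemma desc (h : IsSES ι π) (f : P →ₗ[Γ] L) (hf : ∀ x, f (ι x) = 0) :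
    ∃ g : Y →ₗ[Γ] L, ∀ p, g (π p) = f p :=
  exists_factor_of_surjective h.surj f fun p hp => by
    obtain ⟨x, rfl⟩ := h.exists_of_eq_zero hp
    exact hf x

lemma lift (h : IsSES ι π) (f : L →ₗ[Γ] P) (hf : ∀ l, π (f l) = 0) :
    ∃ g : L →ₗ[Γ] X, ∀ l, ι (g l) = f l :=
  exists_factor_of_injective h.inj f fun l => h.exists_of_eq_zero (hf l)

lemma ker_subtype {π : P →ₗ[Γ] Y} (h : Function.Surjective π) :
    IsSES (LinearMap.ker π).subtype π :=
  ⟨Subtype.val_injective, fun p => by simp, h⟩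

lemma range_mkQ {ι : X →ₗ[Γ] P} (h : Function.Injective ι) :
    IsSES ι (LinearMap.range ι).mkQ :=
  ⟨h, fun p => by simp, Submodule.mkQ_surjective _⟩

lemma inl_snd : IsSES (LinearMap.inl Γ M N) (LinearMap.snd Γ M N) :=
  ⟨LinearMap.inl_injective, Function.Exact.inl_snd, LinearMap.snd_surjective⟩

lemma shortExact (h : IsSES ι π) : (ModuleCat.shortComplexOfCompEqZero ι π
    (LinearMap.ext h.comp_apply)).ShortExact :=
  ModuleCat.shortComplex_shortExact _ h.exact h.inj h.surj

end IsSES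

lemma exists_lift_of_projective [Module.Projective Γ P] {p : M →ₗ[Γ] N}
    (hp : Function.Surjective p) (f : P →ₗ[Γ] N) : ∃ g : P →ₗ[Γ] M, ∀ x, p (g x) = f x := by
  obtain ⟨g, hg⟩ := Module.projective_lifting_property p f hp
  exact ⟨g, fun x => LinearMap.congr_fun hg x⟩

lemma Extends.retract {ι : X →ₗ[Γ] P} (h : Extends ι M) (i : L →ₗ[Γ] M) (r : M →ₗ[Γ] L)
    (hri : ∀ l, r (i l) = l) : Extends ι L := fun g => by
  obtain ⟨g', hg'⟩ := h (i ∘ₗ g)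
  exact ⟨r ∘ₗ g', fun x => by simp [hg', hri]⟩

lemma Extends.pi {ι : X →ₗ[Γ] P} (h : Extends ι L) (J : Type) : Extends ι (J → L) := fun g => by
  choose f hf using fun j => h (LinearMap.proj j ∘ₗ g)
  exact ⟨LinearMap.pi f, fun x => funext fun j => hf j x⟩

/-- A finitely generated projective module is a retract of a finite power of the ring. -/
lemma exists_retract_of_projective (L : Type u) [AddCommGroup L] [Module Γ L] [Module.Finite Γ L]
    [Module.Projective Γ L] :
    ∃ (n : ℕ) (i : L →ₗ[Γ] (Fin n → Γ)) (r : (Fin n → Γ) →ₗ[Γ] L), ∀ l, r (i l) = l := by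
  obtain ⟨n, f, hf⟩ := Module.Finite.exists_fin' Γ L
  obtain ⟨i, hi⟩ := exists_lift_of_projective hf (LinearMap.id : L →ₗ[Γ] L)
  exact ⟨n, i, f, hi⟩

lemma Extends.of_projective {ι : X →ₗ[Γ] P} (h : Extends ι Γ) (L : Type u) [AddCommGroup L]
    [Module Γ L] [Module.Finite Γ L] [Module.Projective Γ L] : Extends ι L := by
  obtain ⟨n, i, r, hri⟩ := exists_retract_of_projective (Γ := Γ) L
  exact (h.pi _).retract i r hri

/-- If maps to `L` extend along the inclusion of the kernel of one projective presentation
`P → Y`, then they extend along the inclusion of the kernel of every surjection onto `Y`. -/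
lemma Extends.of_presentation {ι : X →ₗ[Γ] P} {π : P →ₗ[Γ] Y} (hs : IsSES ι π)
    [Module.Projective Γ P] (h : Extends ι L) {κ : M →ₗ[Γ] N} {ρ : N →ₗ[Γ] Y} (ht : IsSES κ ρ) :
    Extends κ L := fun g => by
  obtain ⟨s, hs'⟩ := exists_lift_of_projective ht.surj π
  obtain ⟨t, ht'⟩ := ht.lift (s ∘ₗ ι) fun x => by simp [hs', hs.comp_apply]
  obtain ⟨v, hv⟩ := h (g ∘ₗ t)
  -- `N` is the pushout of `P` and `M` along `X`
  obtain ⟨w, hw⟩ := exists_factor_of_surjective (p := κ.coprod s) (fun n => by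
      obtain ⟨p, hp⟩ := hs.surj (ρ n)
      obtain ⟨m, hm⟩ := ht.exists_of_eq_zero (p := n - s p) (by simp [hs', hp])
      exact ⟨(m, p), by simp [hm]⟩) (g.coprod v) (by
    rintro ⟨m, p⟩ h0
    have h1 : κ m + s p = 0 := by simpa using h0
    have h2 : π p = 0 := by
      rw [← hs', eq_neg_of_add_eq_zero_right h1, map_neg, ht.comp_apply, neg_zero]
    obtain ⟨x, rfl⟩ := hs.exists_of_eq_zero h2
    have h3 : m = - t x := ht.inj (by
      rw [map_neg, ht']; exact eq_neg_of_add_eq_zero_left h1)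
    simp [hv, h3])
  exact ⟨w, fun m => by simpa using hw (m, 0)⟩

/-- `Ext^i(M, L) = 0` for all `i ≥ 1`. -/
def Perp (Γ L M : Type u) [Ring Γ] [AddCommGroup L] [Module Γ L] [AddCommGroup M]
    [Module Γ M] : Prop :=
  ∀ i : ℕ, Subsingleton (Abelian.Ext.{u} (ModuleCat.of Γ M) (ModuleCat.of Γ L) (i + 1))

lemma Perp.of_projective [Module.Projective Γ M] : Perp Γ L M := fun i => by
  have := (IsProjective.iff_projective (R := Γ) M).1 inferInstance
  exact ⟨fun a b => by rw [a.eq_zero_of_projective, b.eq_zero_of_projective]⟩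

section

variable {ι : X →ₗ[Γ] P} {π : P →ₗ[Γ] Y}

lemma Perp.kernel (hs : IsSES ι π) (hP : Perp Γ L P) (hY : Perp Γ L Y) : Perp Γ L X := fun i => by
  refine subsingleton_of_forall_eq 0 fun a => ?_
  obtain ⟨b, rfl⟩ := Abelian.Ext.contravariant_sequence_exact₁ hs.shortExact _ a
    (add_comm _ _) ((hY (i + 1)).elim _ _)
  rw [(hP i).elim b 0, Abelian.Ext.comp_zero]

lemma Perp.middle (hs : IsSES ι π) (hX : Perp Γ L X) (hY : Perp Γ L Y) : Perp Γ L P := fun i => by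
  refine subsingleton_of_forall_eq 0 fun a => ?_
  obtain ⟨b, rfl⟩ := Abelian.Ext.contravariant_sequence_exact₂ hs.shortExact _ a
    ((hX i).elim _ _)
  rw [(hY i).elim b 0, Abelian.Ext.comp_zero]

lemma Perp.extends (hs : IsSES ι π) (hY : Perp Γ L Y) : Extends ι L := fun g => by
  obtain ⟨b, hb⟩ := Abelian.Ext.contravariant_sequence_exact₁ hs.shortExact (ModuleCat.of Γ L)
    (Abelian.Ext.mk₀ (ModuleCat.ofHom g)) (add_comm _ _) ((hY 0).elim _ _)
  obtain ⟨φ, rfl⟩ := Abelian.Ext.homEquiv₀.symm.surjective b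
  refine ⟨φ.hom, fun x => ?_⟩
  have : ModuleCat.ofHom ι ≫ φ = ModuleCat.ofHom g :=
    Abelian.Ext.homEquiv₀.symm.injective (by simpa using hb)
  exact congrArg (fun f => f.hom x) this

lemma ext_one_subsingleton_of_extends (hs : IsSES ι π) [Module.Projective Γ P] (h : Extends ι L) :
    Subsingleton (Abelian.Ext.{u} (ModuleCat.of Γ Y) (ModuleCat.of Γ L) 1) := by
  refine subsingleton_of_forall_eq 0 fun a => ?_
  obtain ⟨b, rfl⟩ := Abelian.Ext.contravariant_sequence_exact₃ hs.shortExact _ a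
    (((Perp.of_projective (Γ := Γ) (M := P) (L := L)) 0).elim _ _) (add_zero 1)
  obtain ⟨φ, rfl⟩ := Abelian.Ext.homEquiv₀.symm.surjective b
  obtain ⟨ψ, hψ⟩ := h φ.hom
  have : φ = (ModuleCat.shortComplexOfCompEqZero ι π (LinearMap.ext hs.comp_apply)).f ≫
      ModuleCat.ofHom ψ := ModuleCat.hom_ext (LinearMap.ext fun x => (hψ x).symm)
  rw [Abelian.Ext.homEquiv₀_symm_apply, this, ← Abelian.Ext.mk₀_comp_mk₀,
    ← Abelian.Ext.comp_assoc _ _ _ (add_zero 1) (add_zero 0) (by simp),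
    hs.shortExact.extClass_comp, Abelian.Ext.zero_comp]

lemma ext_subsingleton_of_kernel (hs : IsSES ι π) [Module.Projective Γ P] {i : ℕ}
    (h : Subsingleton (Abelian.Ext.{u} (ModuleCat.of Γ X) (ModuleCat.of Γ L) i)) :
    Subsingleton (Abelian.Ext.{u} (ModuleCat.of Γ Y) (ModuleCat.of Γ L) (i + 1)) := by
  refine subsingleton_of_forall_eq 0 fun a => ?_
  obtain ⟨b, rfl⟩ := Abelian.Ext.contravariant_sequence_exact₃ hs.shortExact _ a
    (((Perp.of_projective (Γ := Γ) (M := P) (L := L)) i).elim _ _) (add_comm 1 i)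
  rw [h.elim b 0, Abelian.Ext.comp_zero]

lemma Perp.cokernel (hs : IsSES ι π) [Module.Projective Γ P] (h : Extends ι L)
    (hX : Perp Γ L X) : Perp Γ L Y := fun i =>
  match i with
  | 0 => ext_one_subsingleton_of_extends hs h
  | i + 1 => ext_subsingleton_of_kernel hs (hX i)

/-- Dimension shift in the coefficients. -/
lemma Perp.coefficients (hs : IsSES ι π) (hX : Perp Γ X M) (hP : Perp Γ P M) : Perp Γ Y M :=
  fun i => by
  refine subsingleton_of_forall_eq 0 fun a => ?_
  obtain ⟨b, rfl⟩ := Abelian.Ext.covariant_sequence_exact₃ _ hs.shortExact a rfl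
    ((hX (i + 1)).elim _ _)
  rw [(hP i).elim b 0, Abelian.Ext.zero_comp]

end

/-- If every module of a class is the cokernel, within the class, of a map `X → P` with `P`
projective along which maps to `L` extend, then the class is Ext-orthogonal to `L`. -/
lemma perp_of_left_class (𝒳 : ObjectProperty (ModuleCat.{u} Γ))
    (h : ∀ Y, 𝒳 Y → ∃ (X P : ModuleCat.{u} Γ) (ι : X →ₗ[Γ] P) (π : P →ₗ[Γ] Y), 𝒳 X ∧
      Module.Projective Γ P ∧ IsSES ι π ∧ Extends ι L) {Y : ModuleCat.{u} Γ} (hY : 𝒳 Y) :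
    Perp Γ L Y := fun i => by
  induction i generalizing Y with
  | zero =>
    obtain ⟨X, P, ι, π, -, hP, hs, he⟩ := h Y hY
    exact ext_one_subsingleton_of_extends hs he
  | succ i ih =>
    obtain ⟨X, P, ι, π, hX, hP, hs, he⟩ := h Y hY
    exact ext_subsingleton_of_kernel hs (ih hX)

/-- If every module of a class embeds into a projective module with cokernel in the class, then
the class is Ext-orthogonal to all modules of finite injective dimension. -/
lemma perp_of_right_class (𝒳 : ObjectProperty (ModuleCat.{u} Γ))
    (h : ∀ X, 𝒳 X → ∃ (P Y : ModuleCat.{u} Γ) (ι : X →ₗ[Γ] P) (π : P →ₗ[Γ] Y), 𝒳 Y ∧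
      Module.Projective Γ P ∧ IsSES ι π) {n : ℕ}
    (hL : HasInjectiveDimensionLE (ModuleCat.of Γ L) n) {X : ModuleCat.{u} Γ} (hX : 𝒳 X) :
    Perp Γ L X := by
  -- shifting dimensions to the right until the degree exceeds `n`
  have key : ∀ (m i : ℕ), n ≤ i + m → ∀ X, 𝒳 X →
      Subsingleton (Abelian.Ext.{u} (ModuleCat.of Γ X) (ModuleCat.of Γ L) (i + 1)) := by
    intro m
    induction m with
    | zero => exact fun i hi X _ => HasInjectiveDimensionLT.subsingleton _ (n + 1) _ (by lia) _
    | succ m ih =>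
      intro i hi X hX
      obtain ⟨P, Y, ι, π, hY, hP, hs⟩ := h X hX
      refine subsingleton_of_forall_eq 0 fun a => ?_
      obtain ⟨b, rfl⟩ := Abelian.Ext.contravariant_sequence_exact₁ hs.shortExact _ a
        (add_comm _ _) ((ih (i + 1) (by lia) Y hY).elim _ _)
      rw [((Perp.of_projective (Γ := Γ) (M := P) (L := L)) i).elim b 0, Abelian.Ext.comp_zero]
  exact fun i => key n i (by lia) X hX

lemma Perp.prod (hM : Perp Γ L M) (hN : Perp Γ L N) : Perp Γ L (M × N) :=
  Perp.middle IsSES.inl_snd hM hN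

end ShortExact

/-! ### Gorenstein projective modules without complexes -/

section Gproj

variable {Γ : Type u} [Ring Γ]

/-- There is a short exact sequence `0 → X → P → Y → 0` with `P` finitely generated projective
that stays exact under `Hom(-, Γ)`. -/
def Step (X Y : ModuleCat.{u} Γ) : Prop :=
  ∃ (P : ModuleCat.{u} Γ) (ι : X →ₗ[Γ] P) (π : P →ₗ[Γ] Y), Proj Γ P ∧ IsSES ι π ∧ Extends ι Γ

/-- A relation that can be continued in both directions within a class admits a chain indexed by
the integers through every element of the class. -/
lemma exists_int_chain {α : Type*} (r : α → α → Prop) (p : α → Prop)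
    (hl : ∀ y, p y → ∃ x, p x ∧ r x y) (hr : ∀ x, p x → ∃ y, p y ∧ r x y) (x : α) (hx : p x)
    (j : ℤ) : ∃ Z : ℤ → α, Z j = x ∧ ∀ i, r (Z i) (Z (i + 1)) := by
  choose! l hl using hl
  choose! s hs using hr
  have hsp : ∀ n, p (s^[n] x) := fun n => by
    induction n with
    | zero => exact hx
    | succ n ih => rw [Function.iterate_succ_apply']; exact (hs _ ih).1
  have hlp : ∀ n, p (l^[n] x) := fun n => by
    induction n with
    | zero => exact hx
    | succ n ih => rw [Function.iterate_succ_apply']; exact (hl _ ih).1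
  let Z : ℤ → α := fun i => match i with
    | Int.ofNat n => s^[n] x
    | Int.negSucc n => l^[n + 1] x
  have hZ : ∀ i, r (Z i) (Z (i + 1)) := by
    intro i
    match i with
    | Int.ofNat n =>
      change r (s^[n] x) (s^[n + 1] x)
      rw [Function.iterate_succ_apply']
      exact (hs _ (hsp n)).2
    | Int.negSucc 0 => exact (hl x hx).2
    | Int.negSucc (n + 1) =>
      change r (l^[n + 1 + 1] x) (l^[n + 1] x)
      rw [Function.iterate_succ_apply' _ (n + 1)]
      exact (hl _ (hlp (n + 1))).2
  refine ⟨fun i => Z (i - j), by simp [Z], fun i => ?_⟩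
  have := hZ (i - j)
  rwa [show i - j + 1 = i + 1 - j by ring] at this

/-- A class of finitely generated modules in which every module continues to the left and to the
right by steps consists of Gorenstein projective modules. -/
theorem gproj_of_class (𝒳 : ObjectProperty (ModuleCat.{u} Γ))
    (hfin : ∀ X, 𝒳 X → Module.Finite Γ X) (hl : ∀ Y, 𝒳 Y → ∃ X, 𝒳 X ∧ Step X Y)
    (hr : ∀ X, 𝒳 X → ∃ Y, 𝒳 Y ∧ Step X Y) {X : ModuleCat.{u} Γ} (hX : 𝒳 X) : Gproj Γ X := by
  obtain ⟨Z, hZ, h⟩ := exists_int_chain Step 𝒳 hl hr X hX 1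
  choose P ι π hP hs he using h
  obtain rfl := hZ
  refine ⟨hfin _ hX, ⟨{
    P := P
    finite := fun i => (hP i).1
    projective := fun i => (hP i).2
    d := fun i => ι (i + 1) ∘ₗ π i
    exact := fun i p => ?_
    hom_exact := fun i f => ?_
    iso := ?_ }⟩⟩
  · constructor
    · intro h0
      obtain ⟨z, rfl⟩ := (hs (i + 1)).exists_of_eq_zero
        ((hs (i + 1 + 1)).inj (by simpa using h0))
      obtain ⟨q, rfl⟩ := (hs i).surj z
      exact ⟨q, rfl⟩
    · rintro ⟨q, rfl⟩
      simp [(hs (i + 1)).comp_apply]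
  · constructor
    · intro h0
      obtain ⟨g, hg⟩ := (hs (i + 1)).desc f fun z => by
        obtain ⟨q, rfl⟩ := (hs i).surj z
        exact LinearMap.congr_fun h0 q
      obtain ⟨h, hh⟩ := he (i + 1 + 1) g
      exact ⟨h, LinearMap.ext fun p => by simp [hh, hg]⟩
    · rintro ⟨h, rfl⟩
      exact LinearMap.ext fun p => by simp [(hs (i + 1)).comp_apply]
  · refine (LinearEquiv.ofInjective _ (hs 1).inj).trans (LinearEquiv.ofEq _ _ ?_)
    rw [LinearMap.ker_comp_of_ker_eq_bot _ (LinearMap.ker_eq_bot.2 (hs (1 + 1)).inj)]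
    exact (LinearMap.exact_iff.1 (hs 1).exact).symm

/-- A complete resolution is spliced from the short exact sequences
`0 → Ker (d i) → P i → Ker (d (i + 1)) → 0`, each of which is a step. -/
lemma CompleteResolution.exists_steps {G : ModuleCat.{u} Γ} (C : CompleteResolution Γ G) :
    ∃ Z : ℤ → ModuleCat.{u} Γ, Nonempty (G ≃ₗ[Γ] Z 1) ∧ (∀ i, Module.Finite Γ (Z i)) ∧
      ∀ i, Step (Z i) (Z (i + 1)) := by
  have hs : ∀ i, IsSES (LinearMap.ker (C.d i)).subtype ((C.d i).codRestrict
      (LinearMap.ker (C.d (i + 1))) fun p => (C.exact i).apply_apply_eq_zero p) := fun i =>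
    ⟨Subtype.val_injective, fun p => by
      refine Subtype.ext_iff.trans ⟨fun h => ⟨⟨p, h⟩, rfl⟩, ?_⟩
      rintro ⟨q, rfl⟩
      exact q.2, fun ⟨p, hp⟩ => by
      obtain ⟨q, rfl⟩ := (C.exact i p).1 hp
      exact ⟨q, rfl⟩⟩
  refine ⟨fun i => ModuleCat.of Γ (LinearMap.ker (C.d i)), ⟨C.iso⟩, fun i => ?_, fun i =>
    ⟨C.P i, _, _, ⟨C.finite i, C.projective i⟩, hs i, fun g => ?_⟩⟩
  · obtain ⟨i, rfl⟩ : ∃ j, i = j + 1 := ⟨i - 1, by ring⟩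
    have := C.finite i
    exact Module.Finite.of_surjective _ (hs i).surj
  · obtain ⟨i, rfl⟩ : ∃ j, i = j + 1 + 1 := ⟨i - 2, by ring⟩
    obtain ⟨h, hh⟩ := (C.hom_exact i (g ∘ₗ (C.d (i + 1)).codRestrict
      (LinearMap.ker (C.d (i + 1 + 1))) fun p => (C.exact (i + 1)).apply_apply_eq_zero p)).1
      (LinearMap.ext fun p => by
        change g _ = 0
        rw [← map_zero g]
        exact congrArg g (Subtype.ext ((C.exact i).apply_apply_eq_zero p)))
    refine ⟨h, fun z => ?_⟩
    obtain ⟨p, rfl⟩ := (hs (i + 1)).surj z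
    exact LinearMap.congr_fun hh p

lemma Gproj.finite {G : ModuleCat.{u} Γ} (h : Gproj Γ G) : Module.Finite Γ G := h.1

lemma Step.of_equiv {X X' Y Y' : ModuleCat.{u} Γ} (h : Step X Y) (e : X' ≃ₗ[Γ] X)
    (e' : Y ≃ₗ[Γ] Y') : Step X' Y' := by
  obtain ⟨P, ι, π, hP, hs, he⟩ := h
  refine ⟨P, ι ∘ₗ e.toLinearMap, e'.toLinearMap ∘ₗ π, hP, ⟨hs.inj.comp e.injective, fun p => ?_,
    e'.surjective.comp hs.surj⟩, fun g => ?_⟩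
  · rw [LinearMap.comp_apply, LinearEquiv.coe_coe, LinearEquiv.map_eq_zero_iff, hs.exact p]
    exact ⟨fun ⟨x, hx⟩ => ⟨e.symm x, by simpa using hx⟩, fun ⟨x, hx⟩ => ⟨e x, hx⟩⟩
  · obtain ⟨h, hh⟩ := he (g ∘ₗ e.symm.toLinearMap)
    exact ⟨h, fun x => by simp [hh]⟩

/-- All kernels in a complete resolution are Gorenstein projective, so the class of Gorenstein
projective modules itself satisfies the hypotheses of `gproj_of_class`. -/
lemma Gproj.exists_steps {G : ModuleCat.{u} Γ} (hG : Gproj Γ G) :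
    (∃ X, Gproj Γ X ∧ Step X G) ∧ ∃ Y, Gproj Γ Y ∧ Step G Y := by
  obtain ⟨_, ⟨C⟩⟩ := hG
  obtain ⟨Z, ⟨e⟩, hfin, hZ⟩ := C.exists_steps
  have hg : ∀ i, Gproj Γ (Z i) := fun i => by
    refine gproj_of_class (fun X => ∃ i, X = Z i) ?_ ?_ ?_ ⟨i, rfl⟩
    · rintro _ ⟨i, rfl⟩; exact hfin i
    · rintro _ ⟨i, rfl⟩
      refine ⟨_, ⟨i - 1, rfl⟩, ?_⟩
      have := hZ (i - 1)
      rwa [sub_add_cancel] at this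
    · rintro _ ⟨i, rfl⟩; exact ⟨_, ⟨i + 1, rfl⟩, hZ i⟩
  exact ⟨⟨Z 0, hg 0, (hZ 0).of_equiv (.refl _ _) e.symm⟩, ⟨Z (1 + 1), hg _,
    (hZ 1).of_equiv e (.refl _ _)⟩⟩

lemma Gproj.exists_left {G : ModuleCat.{u} Γ} (hG : Gproj Γ G) : ∃ X, Gproj Γ X ∧ Step X G :=
  hG.exists_steps.1

lemma Gproj.exists_right {G : ModuleCat.{u} Γ} (hG : Gproj Γ G) : ∃ Y, Gproj Γ Y ∧ Step G Y :=
  hG.exists_steps.2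

lemma Gproj.perp {G : ModuleCat.{u} Γ} (hG : Gproj Γ G) : Perp Γ Γ G :=
  perp_of_left_class (Gproj Γ) (fun Y hY => by
    obtain ⟨X, hX, P, ι, π, hP, hs, he⟩ := hY.exists_left
    exact ⟨X, P, ι, π, hX, hP.2, hs, he⟩) hG

lemma proj_le_gproj : Proj Γ ≤ Gproj Γ := by
  refine fun X hX => gproj_of_class (Proj Γ) (fun X hX => hX.1) (fun X hX => ?_)
    (fun X hX => ?_) hX
  · exact ⟨ModuleCat.of Γ PUnit, ⟨inferInstance, inferInstance⟩, X, 0, LinearMap.id, hX,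
      ⟨fun _ _ _ => rfl, fun x => ⟨fun h => ⟨0, h.symm⟩, fun ⟨_, h⟩ => h.symm⟩,
        Function.surjective_id⟩, fun g => ⟨0, fun x => by simp [Subsingleton.elim x 0]⟩⟩
  · exact ⟨ModuleCat.of Γ PUnit, ⟨inferInstance, inferInstance⟩, X, LinearMap.id, 0, hX,
      ⟨fun _ _ h => h, fun x => ⟨fun _ => ⟨x, rfl⟩, fun _ => rfl⟩,
        fun x => ⟨0, rfl⟩⟩, fun g => ⟨g, fun x => rfl⟩⟩

/-- Every finitely generated module over a noetherian ring is the cokernel of a map from a finitely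
generated module to a finitely generated projective module. -/
lemma exists_presentation [IsNoetherianRing Γ] (Y : Type u) [AddCommGroup Y] [Module Γ Y]
    [Module.Finite Γ Y] : ∃ (X P : ModuleCat.{u} Γ) (ι : X →ₗ[Γ] P) (π : P →ₗ[Γ] Y),
      Module.Finite Γ X ∧ Proj Γ P ∧ IsSES ι π := by
  obtain ⟨n, f, hf⟩ := Module.Finite.exists_fin' Γ Y
  exact ⟨ModuleCat.of Γ (LinearMap.ker f), ModuleCat.of Γ (Fin n → Γ), _, f,
    inferInstanceAs (Module.Finite Γ (LinearMap.ker f)),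
    ⟨inferInstanceAs (Module.Finite Γ (Fin n → Γ)),
      inferInstanceAs (Module.Projective Γ (Fin n → Γ))⟩, IsSES.ker_subtype hf⟩

/-- The closure of a class of modules under kernels of surjections from finitely generated
projective modules. -/
inductive SyzygyClosure (𝒞 : ObjectProperty (ModuleCat.{u} Γ)) : ModuleCat.{u} Γ → Prop
  | base {X : ModuleCat.{u} Γ} (h : 𝒞 X) : SyzygyClosure 𝒞 X
  | syzygy {X P Y : ModuleCat.{u} Γ} (ι : X →ₗ[Γ] P) (π : P →ₗ[Γ] Y) (hX : Module.Finite Γ X)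
    (hP : Proj Γ P) (hs : IsSES ι π) (h : SyzygyClosure 𝒞 Y) : SyzygyClosure 𝒞 X

/-- Over a noetherian ring, it is enough to construct complete resolutions to the right, within a
class of modules that are Ext-orthogonal to the ring. -/
theorem gproj_of_perp_class [IsNoetherianRing Γ] (𝒞 : ObjectProperty (ModuleCat.{u} Γ))
    (hfin : ∀ X, 𝒞 X → Module.Finite Γ X) (hperp : ∀ X, 𝒞 X → Perp Γ Γ X)
    (hr : ∀ X, 𝒞 X → ∃ (P Y : ModuleCat.{u} Γ) (ι : X →ₗ[Γ] P) (π : P →ₗ[Γ] Y), 𝒞 Y ∧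
      Proj Γ P ∧ IsSES ι π) {X : ModuleCat.{u} Γ} (hX : 𝒞 X) : Gproj Γ X := by
  have hfin' : ∀ X, SyzygyClosure 𝒞 X → Module.Finite Γ X := fun X h => by
    cases h with
    | base h => exact hfin _ h
    | syzygy ι π hX hP hs h => exact hX
  have hperp' : ∀ X, SyzygyClosure 𝒞 X → Perp Γ Γ X := fun X h => by
    induction h with
    | base h => exact hperp _ h
    | syzygy ι π hX hP hs h ih =>
      have := hP.2
      exact Perp.kernel hs Perp.of_projective ih
  refine gproj_of_class (SyzygyClosure 𝒞) hfin' (fun Y hY => ?_) (fun X hX => ?_) (.base hX)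
  · have := hfin' Y hY
    obtain ⟨X, P, ι, π, hX, hP, hs⟩ := exists_presentation (Γ := Γ) Y
    exact ⟨X, .syzygy ι π hX hP hs hY, P, ι, π, hP, hs, (hperp' Y hY).extends hs⟩
  · cases hX with
    | base h =>
      obtain ⟨P, Y, ι, π, hY, hP, hs⟩ := hr X h
      exact ⟨Y, .base hY, P, ι, π, hP, hs, (hperp Y hY).extends hs⟩
    | syzygy ι π hX hP hs h => exact ⟨_, h, _, ι, π, hP, hs, (hperp' _ h).extends hs⟩

/-- Kernels of surjections from finitely generated projective modules to Gorenstein projective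
modules are Gorenstein projective. -/
lemma Gproj.kernel [IsNoetherianRing Γ] {X P Y : ModuleCat.{u} Γ} {ι : X →ₗ[Γ] P}
    {π : P →ₗ[Γ] Y} (hP : Proj Γ P) (hs : IsSES ι π) (hY : Gproj Γ Y) : Gproj Γ X := by
  have := hP.1
  have := hP.2
  refine gproj_of_perp_class (fun Z => Gproj Γ Z ∨ Z = X) ?_ ?_ ?_ (Or.inr rfl)
  · rintro Z (h | rfl)
    · exact h.finite
    · exact Module.Finite.of_injective ι hs.inj
  · rintro Z (h | rfl)
    · exact h.perp
    · exact Perp.kernel hs Perp.of_projective hY.perp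
  · rintro Z (h | rfl)
    · obtain ⟨Y, hY, P, ι, π, hP, hs, -⟩ := h.exists_right
      exact ⟨P, Y, ι, π, Or.inl hY, hP, hs⟩
    · exact ⟨P, Y, ι, π, Or.inl hY, hP, hs⟩

/-- If `X` is Gorenstein projective, `P` is finitely generated projective and all maps `X → Γ`
extend along an injection `X → P`, then the cokernel `Y` is Gorenstein projective.

With a step `0 → X → P₁ → X₁ → 0` and `0 → X₁ → P₂ → X₂ → 0`, the identity of `X` extends to maps
`α : P → P₁` and `β : P₁ → P`, and these give an exact sequence
`0 → Y → P × P₂ → P₁ × X₂ → 0` whose last term is again such a cokernel. -/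
lemma Gproj.cokernel [IsNoetherianRing Γ] {X P Y : ModuleCat.{u} Γ} {ι : X →ₗ[Γ] P}
    {π : P →ₗ[Γ] Y} (hP : Proj Γ P) (hs : IsSES ι π) (he : Extends ι Γ) (hX : Gproj Γ X) :
    Gproj Γ Y := by
  refine gproj_of_perp_class (fun Z => ∃ (X P : ModuleCat.{u} Γ) (ι : X →ₗ[Γ] P)
    (π : P →ₗ[Γ] Z), Proj Γ P ∧ IsSES ι π ∧ Extends ι Γ ∧ Gproj Γ X) ?_ ?_ ?_
    ⟨X, P, ι, π, hP, hs, he, hX⟩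
  · rintro Z ⟨X, P, ι, π, hP, hs, he, hX⟩
    have := hP.1
    exact Module.Finite.of_surjective π hs.surj
  · rintro Z ⟨X, P, ι, π, hP, hs, he, hX⟩
    have := hP.2
    exact Perp.cokernel hs he hX.perp
  · rintro Z ⟨X, P, ι, π, ⟨_, _⟩, hs, he, hX⟩
    obtain ⟨X₁, hX₁, P₁, ι₁, π₁, ⟨_, _⟩, hs₁, he₁⟩ := hX.exists_right
    obtain ⟨X₂, hX₂, P₂, ι₂, π₂, ⟨_, _⟩, hs₂, he₂⟩ := hX₁.exists_right
    obtain ⟨α, hα⟩ := he.of_projective P₁ ι₁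
    obtain ⟨β, hβ⟩ := he₁.of_projective P ι
    -- `1 - αβ` kills `X`, so it factors through `γ : X₁ → P₁`, and `γ` extends to `θ : P₂ → P₁`
    obtain ⟨γ, hγ⟩ := hs₁.desc (LinearMap.id - α ∘ₗ β) fun x => by simp [hα, hβ]
    obtain ⟨θ, hθ⟩ := he₂.of_projective P₁ γ
    -- `1 - βα` kills `X` and `π₁ α` maps `X` to `0`; together they embed `Y` in `P × P₂`
    obtain ⟨ψ, hψ⟩ := hs.desc ((LinearMap.id - β ∘ₗ α).prod (ι₂ ∘ₗ π₁ ∘ₗ α)) fun x => by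
      simp [hα, hβ, hs₁.comp_apply]
    have hperp : Perp Γ Γ (P₁ × X₂) := Perp.of_projective.prod hX₂.perp
    have hs' : IsSES (LinearMap.inr Γ P₁ P₂ ∘ₗ ι₂)
        (LinearMap.prodMap (LinearMap.id : P₁ →ₗ[Γ] P₁) π₂) := by
      refine ⟨LinearMap.inr_injective.comp hs₂.inj, ?_,
        Function.Surjective.prodMap Function.surjective_id hs₂.surj⟩
      rintro ⟨p, q⟩
      constructor
      · intro h0
        obtain ⟨rfl, h2⟩ : p = 0 ∧ π₂ q = 0 := by simpa using h0
        obtain ⟨x, rfl⟩ := hs₂.exists_of_eq_zero h2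
        exact ⟨x, rfl⟩
      · rintro ⟨x, h⟩
        obtain ⟨rfl, rfl⟩ : 0 = p ∧ ι₂ x = q := by simpa using h
        simp [hs₂.comp_apply]
    refine ⟨ModuleCat.of Γ (P × P₂), ModuleCat.of Γ (P₁ × X₂), ψ,
      ((α ∘ₗ LinearMap.fst Γ P P₂) - θ ∘ₗ LinearMap.snd Γ P P₂).prod (π₂ ∘ₗ LinearMap.snd Γ P P₂),
      ⟨X₁, ModuleCat.of Γ (P₁ × P₂), _, _,
        ⟨inferInstanceAs (Module.Finite Γ (P₁ × P₂)),
          inferInstanceAs (Module.Projective Γ (P₁ × P₂))⟩,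
        hs', hperp.extends hs', hX₁⟩,
      ⟨inferInstanceAs (Module.Finite Γ (P × P₂)),
        inferInstanceAs (Module.Projective Γ (P × P₂))⟩,
      ?_, ?_, ?_⟩
    · refine (injective_iff_map_eq_zero ψ).2 fun z hz => ?_
      obtain ⟨p, rfl⟩ := hs.surj z
      rw [hψ] at hz
      obtain ⟨h1, h2⟩ : p - β (α p) = 0 ∧ ι₂ (π₁ (α p)) = 0 := by simpa using hz
      obtain ⟨x, hx⟩ := hs₁.exists_of_eq_zero (hs₂.inj (h2.trans (map_zero _).symm))
      rw [sub_eq_zero.1 h1, ← hx, hβ, hs.comp_apply]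
    · rintro ⟨p, y⟩
      constructor
      · intro h0
        obtain ⟨h1, h2⟩ : α p - θ y = 0 ∧ π₂ y = 0 := by simpa using h0
        obtain ⟨x, rfl⟩ := hs₂.exists_of_eq_zero h2
        obtain ⟨q, rfl⟩ := hs₁.surj x
        have h3 : α p + α (β q) = q := by
          have : α p = q - α (β q) := by
            rw [sub_eq_zero.1 h1, hθ, hγ]; rfl
          rw [this]; abel
        refine ⟨π (p + β q), ?_⟩
        rw [hψ]
        simp [h3]
      · rintro ⟨z, hz⟩
        obtain ⟨q, rfl⟩ := hs.surj z
        rw [hψ] at hz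
        obtain ⟨rfl, rfl⟩ : q - β (α q) = p ∧ ι₂ (π₁ (α q)) = y := by simpa using hz
        simp [hθ, hγ, hs₂.comp_apply]
    · rintro ⟨q, z⟩
      obtain ⟨y, rfl⟩ := hs₂.surj z
      refine ⟨(β (q + θ y), y - ι₂ (π₁ (q + θ y))), ?_⟩
      have := hγ (q + θ y)
      simp only [LinearMap.sub_apply, LinearMap.id_apply, LinearMap.comp_apply] at this
      refine Prod.ext ?_ ?_
      · change α (β (q + θ y)) - θ (y - ι₂ (π₁ (q + θ y))) = q
        rw [map_sub θ, hθ, this]; abel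
      · change π₂ (y - ι₂ (π₁ (q + θ y))) = π₂ y
        rw [map_sub, hs₂.comp_apply, sub_zero]

end Gproj

/-! ### Restriction of scalars -/

/-- The `S`-module `X`, considered as an `R`-module via `φ : R → S`. -/
def Res {R S : Type u} [Ring R] [Ring S] (_ : R →+* S) (X : Type u) : Type u := X

section Res

variable {R S : Type u} [Ring R] [Ring S] (φ : R →+* S) {X Y : Type u} [AddCommGroup X]
  [Module S X] [AddCommGroup Y] [Module S Y]

instance : AddCommGroup (Res φ X) := inferInstanceAs (AddCommGroup X)

instance : Module R (Res φ X) := Module.compHom X φ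

/-- The underlying additive bijection of the restriction of scalars. -/
def toRes (X : Type u) [AddCommGroup X] : X ≃+ Res φ X := AddEquiv.refl X

/-- An `S`-linear map, considered as an `R`-linear map. -/
def Res.map (f : X →ₗ[S] Y) : Res φ X →ₗ[R] Res φ Y where
  toFun x := toRes φ Y (f ((toRes φ X).symm x))
  map_add' x y := by simp
  map_smul' r x := f.map_smul (φ r) x

lemma exact_res {Z : Type u} [AddCommGroup Z] [Module S Z] {f : X →ₗ[S] Y} {g : Y →ₗ[S] Z}
    (h : Function.Exact f g) : Function.Exact (Res.map φ f) (Res.map φ g) := h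

lemma IsSES.res {P : Type u} [AddCommGroup P] [Module S P] {ι : X →ₗ[S] P} {π : P →ₗ[S] Y}
    (h : IsSES ι π) : IsSES (Res.map φ ι) (Res.map φ π) :=
  ⟨h.inj, h.exact, h.surj⟩

/-- If `S` is projective over `R`, then restriction of scalars preserves projectivity. -/
lemma Res.projective (hS : Module.Projective R (Res φ S)) [Module.Projective S X] :
    Module.Projective R (Res φ X) := by
  obtain ⟨s, hs⟩ := Module.projective_def'.1 ‹Module.Projective S X›
  let e : Res φ (X →₀ S) ≃ₗ[R] (X →₀ Res φ S) :=
    { (toRes φ (X →₀ S)).symm with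
      map_smul' := fun r x => rfl }
  classical
  have : Module.Projective R (X →₀ Res φ S) :=
    Module.Projective.of_equiv (finsuppLequivDFinsupp R).symm
  have : Module.Projective R (Res φ (X →₀ S)) := Module.Projective.of_equiv e.symm
  exact Module.Projective.of_split (Res.map φ s) (Res.map φ (Finsupp.linearCombination S id))
    (LinearMap.ext fun x => LinearMap.congr_fun hs x)

lemma Res.finite (hS : Module.Finite R (Res φ S)) [Module.Finite S X] :
    Module.Finite R (Res φ X) := by
  obtain ⟨n, f, hf⟩ := Module.Finite.exists_fin' S X
  let e : Res φ (Fin n → S) ≃ₗ[R] (Fin n → Res φ S) :=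
    { (toRes φ (Fin n → S)).symm with
      map_smul' := fun r x => rfl }
  have : Module.Finite R (Res φ (Fin n → S)) := Module.Finite.equiv e.symm
  exact Module.Finite.of_surjective (Res.map φ f) hf

end Res

/-! ### Modules over a tensor product of algebras -/

section TensorAlgebra

variable (k A B : Type u) [Field k] [Ring A] [Algebra k A] [Ring B] [Algebra k B]

/-- The ring homomorphism `B → A ⊗ B`. -/
def inclB : B →+* A ⊗[k] B := (Algebra.TensorProduct.includeRight : B →ₐ[k] A ⊗[k] B).toRingHom

variable {k A B} in
/-- An additive map between `A ⊗ B`-modules is linear if it commutes with the actions of `A` and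
of `B`. -/
def linearOfTmul {X Y : Type u} [AddCommGroup X] [Module (A ⊗[k] B) X] [AddCommGroup Y]
    [Module (A ⊗[k] B) Y] (f : X →+ Y) (h : ∀ (a : A) (b : B) x, f ((a ⊗ₜ[k] b) • x) =
      (a ⊗ₜ[k] b) • f x) : X →ₗ[A ⊗[k] B] Y :=
  { f with
    map_smul' := fun r x => by
      induction r using TensorProduct.induction_on with
      | zero => simp
      | add r s hr hs => simpa [add_smul] using congrArg₂ (· + ·) hr hs
      | tmul a b => exact h a b x }

/-- A `k`-basis of `A` identifies the left `B`-module `A ⊗ B` with a direct sum of copies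
of `B`. -/
noncomputable def tensorAlgebraEquiv {J : Type*} [DecidableEq J] (e : Module.Basis J k A) :
    Res (inclB k A B) (A ⊗[k] B) ≃ₗ[B] (J →₀ B) :=
  { ((toRes _ _).symm.trans (TensorProduct.equivFinsuppOfBasisLeft (N := B) e).toAddEquiv) with
    map_smul' := fun b => show ∀ x : A ⊗[k] B,
        TensorProduct.equivFinsuppOfBasisLeft e (((1 : A) ⊗ₜ[k] b) * x) =
          b • TensorProduct.equivFinsuppOfBasisLeft e x from fun x => by
      induction x using TensorProduct.induction_on with
      | zero => simp
      | add x y hx hy => rw [mul_add, map_add, hx, hy, map_add, smul_add]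
      | tmul a b' =>
        ext j
        simp }

lemma projective_res_inclB [FiniteDimensional k A] :
    Module.Projective B (Res (inclB k A B) (A ⊗[k] B)) :=
  Module.Projective.of_equiv (tensorAlgebraEquiv k A B (Module.finBasis k A)).symm

lemma finite_res_inclB [FiniteDimensional k A] :
    Module.Finite B (Res (inclB k A B) (A ⊗[k] B)) :=
  Module.Finite.equiv (tensorAlgebraEquiv k A B (Module.finBasis k A)).symm

end TensorAlgebra

/-! ### The tensor product `(A ⊗ V) ⊗ X` over `A ⊗ B` -/

section Tensor

variable (k A B : Type u) [Field k] [Ring A] [Algebra k A] [Ring B] [Algebra k B]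
variable (V W : Type u) [AddCommGroup V] [Module k V] [Module Bᵐᵒᵖ V] [IsScalarTower k Bᵐᵒᵖ V]
  [AddCommGroup W] [Module k W] [Module Bᵐᵒᵖ W] [IsScalarTower k Bᵐᵒᵖ W]
variable (X Y Z : Type u) [AddCommGroup X] [Module (A ⊗[k] B) X] [AddCommGroup Y]
  [Module (A ⊗[k] B) Y] [AddCommGroup Z] [Module (A ⊗[k] B) Z]

/-- The left `A`-module `(A ⊗ V) ⊗_{A ⊗ B} X`, which as a group is `V ⊗_B X`. -/
abbrev Tens : Type u := BalancedTensor A (A ⊗[k] B) (A ⊗[k] V) X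

/-- The element `v ⊗ x` of `(A ⊗ V) ⊗_{A ⊗ B} X`. -/
noncomputable def tau : V →+ X →+ Tens k A B V X where
  toFun v :=
    { toFun := fun x => Submodule.Quotient.mk (((1 : A) ⊗ₜ[k] v) ⊗ₜ[ℤ] x)
      map_zero' := by rw [TensorProduct.tmul_zero]; rfl
      map_add' := fun x y => by rw [TensorProduct.tmul_add]; rfl }
  map_zero' := by
    ext x
    change Submodule.Quotient.mk (((1 : A) ⊗ₜ[k] (0 : V)) ⊗ₜ[ℤ] x) = 0
    rw [TensorProduct.tmul_zero, TensorProduct.zero_tmul]; rfl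
  map_add' v w := by
    ext x
    change Submodule.Quotient.mk (((1 : A) ⊗ₜ[k] (v + w)) ⊗ₜ[ℤ] x) = _
    rw [TensorProduct.tmul_add, TensorProduct.add_tmul]; rfl

variable {k A B V W X Y Z}

lemma mk_op_smul_tmul (m : A ⊗[k] V) (r : A ⊗[k] B) (x : X) :
    (Submodule.Quotient.mk ((MulOpposite.op r • m) ⊗ₜ[ℤ] x) : Tens k A B V X) =
      Submodule.Quotient.mk (m ⊗ₜ[ℤ] (r • x)) :=
  (Submodule.Quotient.eq _).2 (Submodule.subset_span ⟨m, r, x, rfl⟩)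

lemma mk_tmul_tmul (a : A) (v : V) (x : X) :
    (Submodule.Quotient.mk ((a ⊗ₜ[k] v) ⊗ₜ[ℤ] x) : Tens k A B V X) =
      tau k A B V X v ((a ⊗ₜ[k] (1 : B)) • x) := by
  change _ = Submodule.Quotient.mk _
  rw [← mk_op_smul_tmul, op_tmul_smul_tmul]
  simp

lemma smul_tau (a : A) (v : V) (x : X) :
    a • tau k A B V X v x = tau k A B V X v ((a ⊗ₜ[k] (1 : B)) • x) := by
  rw [← mk_tmul_tmul]
  change Submodule.Quotient.mk (a • (((1 : A) ⊗ₜ[k] v) ⊗ₜ[ℤ] x)) = _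
  rw [TensorProduct.smul_tmul', TensorProduct.smul_tmul', smul_eq_mul, mul_one]

lemma tau_op_smul (b : B) (v : V) (x : X) :
    tau k A B V X (MulOpposite.op b • v) x = tau k A B V X v (((1 : A) ⊗ₜ[k] b) • x) := by
  change _ = Submodule.Quotient.mk _
  rw [← mk_op_smul_tmul, op_tmul_smul_tmul, one_mul]
  rfl

lemma tau_tmul_smul (a : A) (b : B) (v : V) (x : X) :
    tau k A B V X v ((a ⊗ₜ[k] b) • x) = a • tau k A B V X (MulOpposite.op b • v) x := by
  rw [tau_op_smul, smul_tau, smul_smul, Algebra.TensorProduct.tmul_mul_tmul, one_mul, mul_one]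

lemma op_algebraMap_smul (c : k) (v : V) : MulOpposite.op (algebraMap k B c) • v = c • v := by
  rw [← algebraMap_smul Bᵐᵒᵖ c v]
  rfl

lemma tau_smul (c : k) (v : V) (x : X) :
    tau k A B V X (c • v) x = algebraMap k A c • tau k A B V X v x := by
  rw [← op_algebraMap_smul (B := B) c v, tau_op_smul, smul_tau,
    Algebra.TensorProduct.tmul_one_eq_one_tmul]

@[elab_as_elim]
lemma Tens.induction {p : Tens k A B V X → Prop} (z : Tens k A B V X) (zero : p 0)
    (add : ∀ y z, p y → p z → p (y + z)) (tau : ∀ v x, p (tau k A B V X v x)) : p z := by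
  induction z using Submodule.Quotient.induction_on with | _ z => ?_
  induction z using TensorProduct.induction_on with
  | zero => exact zero
  | add y z hy hz => exact add _ _ hy hz
  | tmul m x =>
    induction m using TensorProduct.induction_on with
    | zero => rw [TensorProduct.zero_tmul]; exact zero
    | add y z hy hz => rw [TensorProduct.add_tmul]; exact add _ _ hy hz
    | tmul a v => rw [mk_tmul_tmul]; exact tau _ _

section Lift

variable {N : Type*} [AddCommGroup N] (f : V →+ X →+ N)
    (h : ∀ (b : B) v x, f (MulOpposite.op b • v) x = f v (((1 : A) ⊗ₜ[k] b) • x))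

/-- The universal property of `(A ⊗ V) ⊗_{A ⊗ B} X = V ⊗_B X`: a `B`-balanced biadditive map
induces an additive map. -/
noncomputable def Tens.lift : Tens k A B V X →+ N :=
  let φ : A ⊗[k] V →+ X →+ N := TensorProduct.liftAddHom
    { toFun := fun a =>
        { toFun := fun v => (f v).comp (DistribSMul.toAddMonoidHom X (a ⊗ₜ[k] (1 : B)))
          map_zero' := by ext; simp
          map_add' := fun v w => by ext; simp }
      map_zero' := by ext; simp
      map_add' := fun a b => by ext; simp [TensorProduct.add_tmul, add_smul] }
    (fun c a v => by
      ext x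
      change f v (((c • a) ⊗ₜ[k] (1 : B)) • x) = f (c • v) ((a ⊗ₜ[k] (1 : B)) • x)
      rw [← op_algebraMap_smul (B := B) c v, h, smul_smul, Algebra.TensorProduct.tmul_mul_tmul,
        one_mul, mul_one, Algebra.algebraMap_eq_smul_one, TensorProduct.smul_tmul])
  let ψ : (A ⊗[k] V) ⊗[ℤ] X →+ N := TensorProduct.liftAddHom φ (fun c a v => by simp)
  have hψ : ∀ (m : A ⊗[k] V) (r : A ⊗[k] B) (x : X),
      ψ ((MulOpposite.op r • m) ⊗ₜ[ℤ] x) = ψ (m ⊗ₜ[ℤ] (r • x)) := fun m r x => by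
    change φ (MulOpposite.op r • m) x = φ m (r • x)
    induction r using TensorProduct.induction_on with
    | zero => simp
    | add r s hr hs => simp only [MulOpposite.op_add, add_smul, map_add, ← hr, ← hs]; rfl
    | tmul a b =>
      induction m using TensorProduct.induction_on with
      | zero => simp
      | add m n hm hn => simp only [smul_add, map_add, AddMonoidHom.add_apply, hm, hn]
      | tmul a' v =>
        rw [op_tmul_smul_tmul]
        change f (MulOpposite.op b • v) (((a' * a) ⊗ₜ[k] (1 : B)) • x) =
          f v ((a' ⊗ₜ[k] (1 : B)) • (a ⊗ₜ[k] b) • x)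
        rw [h, smul_smul, smul_smul, Algebra.TensorProduct.tmul_mul_tmul,
          Algebra.TensorProduct.tmul_mul_tmul, one_mul, mul_one, one_mul]
  QuotientAddGroup.lift (balancedRel A (A ⊗[k] B) (A ⊗[k] V) X).toAddSubgroup ψ (fun z hz => by
    suffices ∀ a : A, ψ (a • z) = 0 by simpa using this 1
    refine Submodule.span_induction (p := fun z _ => ∀ a : A, ψ (a • z) = 0) ?_ (by simp)
      (fun y z _ _ hy hz a => by rw [smul_add, map_add, hy, hz, add_zero])
      (fun r z _ hz a => by rw [smul_smul, hz]) hz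
    rintro _ ⟨m, r, x, rfl⟩ a
    rw [smul_sub, TensorProduct.smul_tmul', TensorProduct.smul_tmul', smul_comm, map_sub, hψ,
      sub_self])

lemma Tens.lift_tau (v : V) (x : X) : Tens.lift f h (tau k A B V X v x) = f v x := by
  change f v (((1 : A) ⊗ₜ[k] (1 : B)) • x) = _
  rw [← Algebra.TensorProduct.one_def, one_smul]

end Lift

variable (k A B V) in
/-- The `A`-linear map `V ⊗_B X → V ⊗_B Y` induced by `f : X → Y`. -/
noncomputable def Tens.map (f : X →ₗ[A ⊗[k] B] Y) : Tens k A B V X →ₗ[A] Tens k A B V Y :=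
  BalancedTensor.map A (A ⊗[k] B) (A ⊗[k] V) f

lemma Tens.map_tau (f : X →ₗ[A ⊗[k] B] Y) (v : V) (x : X) :
    Tens.map k A B V f (tau k A B V X v x) = tau k A B V Y v (f x) := rfl

variable (k A B V) in
/-- The additive map `V ⊗_B X → V ⊗_B Y` induced by a `B`-linear map `X → Y`. -/
noncomputable def Tens.mapRes (f : Res (inclB k A B) X →ₗ[B] Res (inclB k A B) Y) :
    Tens k A B V X →+ Tens k A B V Y :=
  Tens.lift ((tau k A B V Y).compr₂ (.id _) |>.compl₂
    (((toRes _ Y).symm.toAddMonoidHom.comp f.toAddMonoidHom).comp (toRes _ X).toAddMonoidHom))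
    fun b v x => by
      change tau k A B V Y (MulOpposite.op b • v) ((toRes _ Y).symm (f (toRes _ X x))) =
        tau k A B V Y v ((toRes _ Y).symm (f (b • toRes _ X x)))
      rw [tau_op_smul, f.map_smul]
      rfl

lemma Tens.mapRes_tau (f : Res (inclB k A B) X →ₗ[B] Res (inclB k A B) Y) (v : V) (x : X) :
    Tens.mapRes k A B V f (tau k A B V X v x) =
      tau k A B V Y v ((toRes _ Y).symm (f (toRes _ X x))) := Tens.lift_tau _ _ v x

/-- An additive map out of `V ⊗_B X` is `A`-linear if it commutes with `A` on pure tensors. -/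
noncomputable def Tens.linear {N : Type*} [AddCommGroup N] [Module A N] (g : Tens k A B V X →+ N)
    (h : ∀ (a : A) v x, g (tau k A B V X v ((a ⊗ₜ[k] (1 : B)) • x)) = a • g (tau k A B V X v x)) :
    Tens k A B V X →ₗ[A] N :=
  { g with
    map_smul' := fun a z => by
      change g (a • z) = a • g z
      induction z using Tens.induction with
      | zero => simp
      | add y z hy hz => rw [smul_add, map_add, hy, hz, map_add, smul_add]
      | tau v x => rw [smul_tau, h] }

lemma Tens.linear_apply {N : Type*} [AddCommGroup N] [Module A N] (g : Tens k A B V X →+ N)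
    (h : ∀ (a : A) v x, g (tau k A B V X v ((a ⊗ₜ[k] (1 : B)) • x)) = a • g (tau k A B V X v x))
    (z) : Tens.linear g h z = g z := rfl

variable (k A X) in
/-- The `A`-linear map `V ⊗_B X → W ⊗_B X` induced by a map of right `B`-modules. -/
noncomputable def Tens.mapLeft (j : V →ₗ[Bᵐᵒᵖ] W) : Tens k A B V X →ₗ[A] Tens k A B W X :=
  Tens.linear (Tens.lift ((tau k A B W X).comp j.toAddMonoidHom) fun b v x => by
    change tau k A B W X (j (MulOpposite.op b • v)) x = tau k A B W X (j v) _
    rw [map_smul, tau_op_smul]) fun a v x => by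
    rw [Tens.lift_tau, Tens.lift_tau]
    exact (smul_tau a (j v) x).symm

lemma Tens.mapLeft_tau (j : V →ₗ[Bᵐᵒᵖ] W) (v : V) (x : X) :
    Tens.mapLeft k A X j (tau k A B V X v x) = tau k A B W X (j v) x := by
  rw [Tens.mapLeft, Tens.linear_apply, Tens.lift_tau]
  rfl

lemma Tens.mapLeft_map (j : V →ₗ[Bᵐᵒᵖ] W) (f : X →ₗ[A ⊗[k] B] Y) (z : Tens k A B V X) :
    Tens.mapLeft k A Y j (Tens.map k A B V f z) = Tens.map k A B W f (Tens.mapLeft k A X j z) := by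
  induction z using Tens.induction with
  | zero => simp
  | add y z hy hz => simp only [map_add, hy, hz]
  | tau v x => rw [Tens.map_tau, Tens.mapLeft_tau, Tens.mapLeft_tau, Tens.map_tau]

lemma Tens.map_surjective {f : X →ₗ[A ⊗[k] B] Y} (hf : Function.Surjective f) :
    Function.Surjective (Tens.map k A B V f) := fun z => by
  induction z using Tens.induction with
  | zero => exact ⟨0, map_zero _⟩
  | add y z hy hz =>
    obtain ⟨y, rfl⟩ := hy
    obtain ⟨z, rfl⟩ := hz
    exact ⟨y + z, map_add _ _ _⟩
  | tau v y =>
    obtain ⟨x, rfl⟩ := hf y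
    exact ⟨tau k A B V X v x, rfl⟩

/-- The functor `V ⊗_B -` preserves exactness of a sequence that is split exact over `B` in the
middle. -/
lemma Tens.exact_of_homotopy {f : X →ₗ[A ⊗[k] B] Y} {g : Y →ₗ[A ⊗[k] B] Z}
    (hfg : ∀ x, g (f x) = 0) (s : Res (inclB k A B) Y →ₗ[B] Res (inclB k A B) X)
    (t : Res (inclB k A B) Z →ₗ[B] Res (inclB k A B) Y)
    (h : ∀ y, Res.map _ f (s y) + t (Res.map _ g y) = y) :
    Function.Exact (Tens.map k A B V f) (Tens.map k A B V g) := fun z => by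
  constructor
  · intro hz
    have key : ∀ y, Tens.map k A B V f (Tens.mapRes k A B V s y) +
        Tens.mapRes k A B V t (Tens.map k A B V g y) = y := fun y => by
      induction y using Tens.induction with
      | zero => simp
      | add y z hy hz =>
        simp only [map_add]
        rw [add_add_add_comm, hy, hz]
      | tau v y =>
        rw [Tens.map_tau, Tens.mapRes_tau, Tens.mapRes_tau, Tens.map_tau, ← map_add]
        exact congrArg _ (h (toRes _ Y y))
    exact ⟨Tens.mapRes k A B V s z, by simpa [hz] using key z⟩
  · rintro ⟨x, rfl⟩
    induction x using Tens.induction with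
    | zero => simp
    | add y z hy hz => rw [map_add, map_add, hy, hz, add_zero]
    | tau v x => rw [Tens.map_tau, Tens.map_tau, hfg, map_zero]

/-- The functor `V ⊗_B -` is exact on short exact sequences whose last term is projective over
`B`. -/
lemma IsSES.tens {ι : X →ₗ[A ⊗[k] B] Y} {π : Y →ₗ[A ⊗[k] B] Z} (h : IsSES ι π)
    [Module.Projective B (Res (inclB k A B) Z)] :
    IsSES (Tens.map k A B V ι) (Tens.map k A B V π) := by
  obtain ⟨t, ht⟩ := exists_lift_of_projective (h.res (inclB k A B)).surj LinearMap.id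
  obtain ⟨s, hs⟩ := (h.res (inclB k A B)).lift (LinearMap.id - t ∘ₗ Res.map _ π) fun y => by
    simp [ht]
  refine ⟨fun y z hyz => ?_, Tens.exact_of_homotopy h.comp_apply s t fun y => by simp [hs],
    Tens.map_surjective h.surj⟩
  have key : ∀ z, Tens.mapRes k A B V s (Tens.map k A B V ι z) = z := fun z => by
    induction z using Tens.induction with
    | zero => simp
    | add y z hy hz => simp only [map_add, hy, hz]
    | tau v x =>
      rw [Tens.map_tau, Tens.mapRes_tau]
      have : s (Res.map _ ι (toRes _ X x)) = toRes _ X x :=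
        (h.res (inclB k A B)).inj (by
          rw [hs, LinearMap.sub_apply, LinearMap.comp_apply, (h.res (inclB k A B)).comp_apply]
          simp)
      exact congrArg _ this
  rw [← key y, ← key z, hyz]

/-- For a right `B`-module `V ⊆ W` and a `B`-projective `X`, the map `V ⊗_B X → W ⊗_B X` is
injective: a dual basis of `X` identifies `V ⊗_B X` with a direct summand of a direct sum of copies
of `V`. -/
lemma Tens.mapLeft_injective {j : V →ₗ[Bᵐᵒᵖ] W} (hj : Function.Injective j)
    [Module.Projective B (Res (inclB k A B) X)] :
    Function.Injective (Tens.mapLeft k A X j) := by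
  obtain ⟨s, hs⟩ := Module.projective_def'.1 ‹Module.Projective B (Res (inclB k A B) X)›
  let act (V : Type u) [AddCommGroup V] [Module Bᵐᵒᵖ V] (v : V) : B →+ V :=
    AddMonoidHom.mk' (fun b => MulOpposite.op b • v) fun b c => by
      rw [MulOpposite.op_add, add_smul]
  -- `coord V` is the map `v ⊗ x ↦ ∑ y, v * (s x) y`
  let coord (V : Type u) [AddCommGroup V] [Module k V] [Module Bᵐᵒᵖ V] [IsScalarTower k Bᵐᵒᵖ V] :
      Tens k A B V X →+ (Res (inclB k A B) X →₀ V) := Tens.lift (AddMonoidHom.mk' (fun v =>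
        (Finsupp.mapRange.addMonoidHom (act V v)).comp (s.toAddMonoidHom.comp
          (toRes (inclB k A B) X).toAddMonoidHom)) fun v w => by ext x y; simp [act])
      fun b v x => by
    ext y
    change MulOpposite.op (s (toRes _ X x) y) • MulOpposite.op b • v =
      MulOpposite.op (s (b • toRes _ X x) y) • v
    rw [smul_smul, map_smul]
    rfl
  have coord_tau (V : Type u) [AddCommGroup V] [Module k V] [Module Bᵐᵒᵖ V]
      [IsScalarTower k Bᵐᵒᵖ V] (v : V) (x : X) (y) : coord V (tau k A B V X v x) y =
      MulOpposite.op (s (toRes _ X x) y) • v := by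
    rw [Tens.lift_tau]; rfl
  have nat : ∀ z y, j (coord V z y) = coord W (Tens.mapLeft k A X j z) y := fun z y => by
    induction z using Tens.induction with
    | zero => simp
    | add z z' hz hz' => simp only [map_add, Finsupp.add_apply, hz, hz']
    | tau v x => rw [Tens.mapLeft_tau, coord_tau, coord_tau, map_smul]
  let dec : (Res (inclB k A B) X →₀ V) →+ Tens k A B V X :=
    Finsupp.liftAddHom fun y => (tau k A B V X).flip ((toRes _ X).symm y)
  have hdec : ∀ z, dec (coord V z) = z := fun z => by
    induction z using Tens.induction with
    | zero => simp
    | add z z' hz hz' => rw [map_add, map_add, hz, hz']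
    | tau v x =>
      have h1 : dec (coord V (tau k A B V X v x)) = (s (toRes _ X x)).sum fun y b =>
          tau k A B V X v (((1 : A) ⊗ₜ[k] b) • (toRes _ X).symm y) := by
        rw [Tens.lift_tau]
        change ((s (toRes _ X x)).mapRange (act V v) (map_zero _)).sum _ = _
        rw [Finsupp.sum_mapRange_index (by simp)]
        exact Finsupp.sum_congr fun y _ => tau_op_smul _ _ _
      rw [h1, Finsupp.sum, ← map_sum]
      exact congrArg (tau k A B V X v) (LinearMap.congr_fun hs (toRes _ X x))
  refine (injective_iff_map_eq_zero _).2 fun z hz => ?_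
  have : coord V z = 0 := by
    ext y
    exact hj (by rw [nat, hz]; simp)
  rw [← hdec z, this, map_zero]

end Tensor

/-! ### Hom over the ground field as a module over `A ⊗ B` -/

section Coind

variable (k A B : Type u) [Field k] [Ring A] [Algebra k A] [Ring B] [Algebra k B]

/-- `Hom_k(V, N)` for a right `B`-module `V` and a left `A`-module `N`, as a left
`A ⊗ B`-module. -/
def CoindB (V N : Type u) [AddCommGroup V] [Module k V] [AddCommGroup N] [Module k N] : Type u :=
  V →ₗ[k] N

/-- `Hom_k(N, B)` for a right `A`-module `N`, as a left `A ⊗ B`-module. -/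
def CoindA (N : Type u) [AddCommGroup N] [Module k N] : Type u :=
  N →ₗ[k] B

/-- The action of an algebra on `Hom_k(V, N)` by a left action on `N`. -/
def postAct (V N : Type u) [AddCommGroup V] [Module k V] [AddCommGroup N] [Module k N] [Module A N]
    [IsScalarTower k A N] : A →ₐ[k] Module.End k (V →ₗ[k] N) :=
  Algebra.lsmul k k (V →ₗ[k] N)

/-- The action of an algebra on `Hom_k(V, N)` by a right action on `V`. -/
def preAct (V N : Type u) [AddCommGroup V] [Module k V] [Module Bᵐᵒᵖ V] [IsScalarTower k Bᵐᵒᵖ V]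
    [AddCommGroup N] [Module k N] : B →ₐ[k] Module.End k (V →ₗ[k] N) where
  toFun b := LinearMap.lcomp k N (Algebra.lsmul k k V (MulOpposite.op b))
  map_one' := by ext f v; simp
  map_mul' b c := by ext f v; simp
  map_zero' := by ext f v; simp
  map_add' b c := by ext f v; simp
  commutes' c := by
    ext f v
    change f (MulOpposite.op (algebraMap k B c) • v) = c • f v
    rw [op_algebraMap_smul, map_smul]

section

variable (V N : Type u) [AddCommGroup V] [Module k V] [Module Bᵐᵒᵖ V] [IsScalarTower k Bᵐᵒᵖ V]
  [AddCommGroup N] [Module k N] [Module A N] [IsScalarTower k A N]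

instance : AddCommGroup (CoindB k V N) := inferInstanceAs (AddCommGroup (V →ₗ[k] N))

instance : FunLike (CoindB k V N) V N := inferInstanceAs (FunLike (V →ₗ[k] N) V N)

instance : LinearMapClass (CoindB k V N) k V N :=
  inferInstanceAs (LinearMapClass (V →ₗ[k] N) k V N)

instance : Module (A ⊗[k] B) (CoindB k V N) :=
  Module.compHom (V →ₗ[k] N) (Algebra.TensorProduct.lift (postAct k A V N) (preAct k B V N)
    fun a b => by ext f v; simp [postAct, preAct]).toRingHom

variable {k A B V N}

@[ext]
lemma CoindB.ext {f g : CoindB k V N} (h : ∀ v, f v = g v) : f = g := LinearMap.ext h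

lemma CoindB.add_apply (f g : CoindB k V N) (v : V) : (f + g) v = f v + g v := rfl

variable (k V N) in
/-- The linear maps, as elements of the type synonym. -/
def CoindB.equiv : (V →ₗ[k] N) ≃+ CoindB k V N := AddEquiv.refl _

lemma CoindB.equiv_apply (f : V →ₗ[k] N) (v : V) : CoindB.equiv k V N f v = f v := rfl

lemma CoindB.tmul_smul_apply (a : A) (b : B) (f : CoindB k V N) (v : V) :
    ((a ⊗ₜ[k] b) • f) v = a • f (MulOpposite.op b • v) := rfl

end

section

variable (N : Type u) [AddCommGroup N] [Module k N] [Module Aᵐᵒᵖ N] [IsScalarTower k Aᵐᵒᵖ N]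

instance : AddCommGroup (CoindA k B N) := inferInstanceAs (AddCommGroup (N →ₗ[k] B))

instance : FunLike (CoindA k B N) N B := inferInstanceAs (FunLike (N →ₗ[k] B) N B)

instance : LinearMapClass (CoindA k B N) k N B :=
  inferInstanceAs (LinearMapClass (N →ₗ[k] B) k N B)

instance : Module (A ⊗[k] B) (CoindA k B N) :=
  Module.compHom (N →ₗ[k] B) (Algebra.TensorProduct.lift (preAct k A N B) (postAct k B N B)
    fun a b => by ext f v; simp [postAct, preAct]).toRingHom

variable {k A B N}

@[ext]
lemma CoindA.ext {f g : CoindA k B N} (h : ∀ v, f v = g v) : f = g := LinearMap.ext h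

lemma CoindA.add_apply (f g : CoindA k B N) (n : N) : (f + g) n = f n + g n := rfl

variable (k B N) in
/-- The linear maps, as elements of the type synonym. -/
def CoindA.equiv : (N →ₗ[k] B) ≃+ CoindA k B N := AddEquiv.refl _

lemma CoindA.equiv_apply (f : N →ₗ[k] B) (n : N) : CoindA.equiv k B N f n = f n := rfl

lemma CoindA.tmul_smul_apply (a : A) (b : B) (f : CoindA k B N) (n : N) :
    ((a ⊗ₜ[k] b) • f) n = b * f (MulOpposite.op a • n) := rfl

end

section Comap

variable {k A B}

variable (A) in
/-- Precomposition with a map of right `B`-modules. -/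
def CoindB.comap (N : Type u) [AddCommGroup N] [Module k N] [Module A N] [IsScalarTower k A N]
    {V W : Type u} [AddCommGroup V] [Module k V] [Module Bᵐᵒᵖ V] [IsScalarTower k Bᵐᵒᵖ V]
    [AddCommGroup W] [Module k W] [Module Bᵐᵒᵖ W] [IsScalarTower k Bᵐᵒᵖ W] (u : V →ₗ[Bᵐᵒᵖ] W) :
    CoindB k W N →ₗ[A ⊗[k] B] CoindB k V N :=
  linearOfTmul (AddMonoidHom.mk' (fun f => CoindB.equiv k V N
      (((CoindB.equiv k W N).symm f).comp (u.restrictScalars k))) fun _ _ => rfl)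
    fun a b f => CoindB.ext fun v =>
      congrArg (fun w => a • f w) (u.map_smul (MulOpposite.op b) v).symm

variable (B) in
/-- Precomposition with a map of right `A`-modules. -/
def CoindA.comap {V W : Type u} [AddCommGroup V] [Module k V] [Module Aᵐᵒᵖ V]
    [IsScalarTower k Aᵐᵒᵖ V] [AddCommGroup W] [Module k W] [Module Aᵐᵒᵖ W]
    [IsScalarTower k Aᵐᵒᵖ W] (u : V →ₗ[Aᵐᵒᵖ] W) :
    CoindA k B W →ₗ[A ⊗[k] B] CoindA k B V :=
  linearOfTmul (AddMonoidHom.mk' (fun f => CoindA.equiv k B V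
      (((CoindA.equiv k B W).symm f).comp (u.restrictScalars k))) fun _ _ => rfl)
    fun a b f => CoindA.ext fun v =>
      congrArg (fun w => b * f w) (u.map_smul (MulOpposite.op a) v).symm

lemma CoindA.comap_apply {V W : Type u} [AddCommGroup V] [Module k V] [Module Aᵐᵒᵖ V]
    [IsScalarTower k Aᵐᵒᵖ V] [AddCommGroup W] [Module k W] [Module Aᵐᵒᵖ W]
    [IsScalarTower k Aᵐᵒᵖ W] (u : V →ₗ[Aᵐᵒᵖ] W) (f : CoindA k B W) (v : V) :
    CoindA.comap B u f v = f (u v) := rfl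

end Comap

section Regular

/-- The isomorphism `A ⊗ B ≅ Hom_k(D B, A)`. -/
noncomputable def coindBEquiv [FiniteDimensional k B] :
    (A ⊗[k] B) ≃ₗ[A ⊗[k] B] CoindB k (D k B) A :=
  let e : A ⊗[k] B ≃ₗ[k] (Module.Dual k B →ₗ[k] A) :=
    (TensorProduct.comm k A B).trans ((TensorProduct.congr (Module.evalEquiv k B)
      (LinearEquiv.refl k A)).trans (dualTensorHomEquiv k (Module.Dual k B) A))
  have he : ∀ (a : A) (b : B) (φ : Module.Dual k B), e (a ⊗ₜ b) φ = φ b • a := fun a b φ => by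
    simp [e]
  let E : A ⊗[k] B ≃+ CoindB k (D k B) A := e.toAddEquiv.trans (CoindB.equiv k (D k B) A)
  have hE : ∀ (a : A) (b : B) (φ : D k B), E (a ⊗ₜ b) φ = φ b • a := he
  LinearEquiv.ofBijective (linearOfTmul E.toAddMonoidHom
    fun a b => show ∀ x : A ⊗[k] B, E ((a ⊗ₜ b) • x) = (a ⊗ₜ b) • E x from fun x => by
      induction x using TensorProduct.induction_on with
      | zero => simp
      | add x y hx hy => rw [smul_add, map_add, hx, hy, map_add, smul_add]
      | tmul a' b' =>
        ext φ
        rw [smul_eq_mul, Algebra.TensorProduct.tmul_mul_tmul, hE, CoindB.tmul_smul_apply, hE,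
          smul_eq_mul, mul_smul_comm, D.op_smul_apply, smul_eq_mul]) E.bijective

/-- The isomorphism `A ⊗ B ≅ Hom_k(D A, B)`. -/
noncomputable def coindAEquiv [FiniteDimensional k A] :
    (A ⊗[k] B) ≃ₗ[A ⊗[k] B] CoindA k B (D k A) :=
  let e : A ⊗[k] B ≃ₗ[k] (Module.Dual k A →ₗ[k] B) :=
    (TensorProduct.congr (Module.evalEquiv k A) (LinearEquiv.refl k B)).trans
      (dualTensorHomEquiv k (Module.Dual k A) B)
  have he : ∀ (a : A) (b : B) (φ : Module.Dual k A), e (a ⊗ₜ b) φ = φ a • b := fun a b φ => by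
    simp [e]
  let E : A ⊗[k] B ≃+ CoindA k B (D k A) := e.toAddEquiv.trans (CoindA.equiv k B (D k A))
  have hE : ∀ (a : A) (b : B) (φ : D k A), E (a ⊗ₜ b) φ = φ a • b := he
  LinearEquiv.ofBijective (linearOfTmul E.toAddMonoidHom
    fun a b => show ∀ x : A ⊗[k] B, E ((a ⊗ₜ b) • x) = (a ⊗ₜ b) • E x from fun x => by
      induction x using TensorProduct.induction_on with
      | zero => simp
      | add x y hx hy => rw [smul_add, map_add, hx, hy, map_add, smul_add]
      | tmul a' b' =>
        ext φ
        rw [smul_eq_mul, Algebra.TensorProduct.tmul_mul_tmul, hE, CoindA.tmul_smul_apply, hE,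
          mul_smul_comm, D.op_smul_apply, smul_eq_mul]) E.bijective

variable {k A B}
variable {X P : Type u} [AddCommGroup X] [Module (A ⊗[k] B) X] [AddCommGroup P]
  [Module (A ⊗[k] B) P] {ι : X →ₗ[A ⊗[k] B] P}

lemma Extends.of_coindB [FiniteDimensional k B] (h : Extends ι (CoindB k (D k B) A)) :
    Extends ι (A ⊗[k] B) :=
  h.retract (coindBEquiv k A B).toLinearMap (coindBEquiv k A B).symm.toLinearMap (by simp)

/-- The module `Hom_k((DB)^J, A)` is a power of `Hom_k(DB, A) ≅ A ⊗ B`. -/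
lemma Extends.coindB [FiniteDimensional k B] (h : Extends ι (A ⊗[k] B)) (J : Type) [Finite J] :
    Extends ι (CoindB k (J → D k B) A) := by
  have := Fintype.ofFinite J
  classical
  refine ((h.retract (coindBEquiv k A B).symm.toLinearMap (coindBEquiv k A B).toLinearMap
    (by simp)).pi J).retract
    (LinearMap.pi fun j => CoindB.comap A A (LinearMap.single Bᵐᵒᵖ (fun _ : J => D k B) j))
    (∑ j, CoindB.comap A A (LinearMap.proj j) ∘ₗ LinearMap.proj j) fun f => CoindB.ext fun v => ?_
  have hsum : ∀ (s : Finset J) (g : J → CoindB k (J → D k B) A),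
      (∑ j ∈ s, g j) v = ∑ j ∈ s, g j v :=
    fun s g => map_sum (AddMonoidHom.mk' (fun f : CoindB k (J → D k B) A => f v) fun f g => rfl) g s
  rw [LinearMap.sum_apply, hsum]
  refine (Finset.sum_congr rfl fun j _ => ?_).trans ((map_sum f (fun j => Pi.single j (v j))
    Finset.univ).symm.trans (congrArg f (Finset.univ_sum_single v)))
  rfl

/-- The module `Hom_k((DA)^J, B)` is a power of `Hom_k(DA, B) ≅ A ⊗ B`. -/
lemma Extends.coindA [FiniteDimensional k A] (h : Extends ι (A ⊗[k] B)) (J : Type) [Finite J] :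
    Extends ι (CoindA k B (J → D k A)) := by
  have := Fintype.ofFinite J
  classical
  refine ((h.retract (coindAEquiv k A B).symm.toLinearMap (coindAEquiv k A B).toLinearMap
    (by simp)).pi J).retract
    (LinearMap.pi fun j => CoindA.comap B (LinearMap.single Aᵐᵒᵖ (fun _ : J => D k A) j))
    (∑ j, CoindA.comap B (LinearMap.proj j) ∘ₗ LinearMap.proj j) fun f => CoindA.ext fun v => ?_
  have hsum : ∀ (s : Finset J) (g : J → CoindA k B (J → D k A)),
      (∑ j ∈ s, g j) v = ∑ j ∈ s, g j v :=
    fun s g => map_sum (AddMonoidHom.mk' (fun f : CoindA k B (J → D k A) => f v) fun f g => rfl) g s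
  rw [LinearMap.sum_apply, hsum]
  refine (Finset.sum_congr rfl fun j _ => ?_).trans ((map_sum f (fun j => Pi.single j (v j))
    Finset.univ).symm.trans (congrArg f (Finset.univ_sum_single v)))
  rfl

end Regular

section Adjunction

variable {k A B}

lemma Tens.linear_ext {V N X : Type u} [AddCommGroup V] [Module k V] [Module Bᵐᵒᵖ V]
    [IsScalarTower k Bᵐᵒᵖ V] [AddCommGroup N] [Module A N] [AddCommGroup X] [Module (A ⊗[k] B) X]
    {f g : Tens k A B V X →ₗ[A] N}
    (h : ∀ v x, f (tau k A B V X v x) = g (tau k A B V X v x)) (z) : f z = g z := by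
  induction z using Tens.induction with
  | zero => simp
  | add y z hy hz => rw [map_add, map_add, hy, hz]
  | tau v x => exact h v x

variable {V N X P : Type u} [AddCommGroup V] [Module k V] [Module Bᵐᵒᵖ V] [IsScalarTower k Bᵐᵒᵖ V]
  [AddCommGroup N] [Module k N] [Module A N] [IsScalarTower k A N]
  [AddCommGroup X] [Module (A ⊗[k] B) X] [AddCommGroup P] [Module (A ⊗[k] B) P]

/-- The map `X → Hom_k(V, N)` corresponding to a map `V ⊗_B X → N`. -/
noncomputable def Tens.curry (g : Tens k A B V X →ₗ[A] N) : X →ₗ[A ⊗[k] B] CoindB k V N :=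
  linearOfTmul (AddMonoidHom.mk' (fun x => CoindB.equiv k V N
      { toFun := fun v => g (tau k A B V X v x)
        map_add' := fun v w => by simp
        map_smul' := fun c v => by
          rw [tau_smul, map_smul, algebraMap_smul, RingHom.id_apply] })
      fun x y => CoindB.ext fun v => by simp [CoindB.equiv_apply, CoindB.add_apply])
    fun a b x => CoindB.ext fun v => by
      simp [CoindB.equiv_apply, CoindB.tmul_smul_apply, tau_tmul_smul]

lemma Tens.curry_apply (g : Tens k A B V X →ₗ[A] N) (x : X) (v : V) :
    Tens.curry g x v = g (tau k A B V X v x) := rfl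

/-- The map `V ⊗_B X → N` corresponding to a map `X → Hom_k(V, N)`. -/
noncomputable def Tens.uncurry (f : X →ₗ[A ⊗[k] B] CoindB k V N) : Tens k A B V X →ₗ[A] N :=
  Tens.linear (Tens.lift (AddMonoidHom.mk' (fun v => AddMonoidHom.mk' (fun x => f x v)
      fun x y => by rw [map_add, CoindB.add_apply]) fun v w => by ext x; simp)
    fun b v x => by simp [CoindB.tmul_smul_apply]) fun a v x => by
      rw [Tens.lift_tau, Tens.lift_tau]
      simp [CoindB.tmul_smul_apply]

lemma Tens.uncurry_tau (f : X →ₗ[A ⊗[k] B] CoindB k V N) (v : V) (x : X) :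
    Tens.uncurry f (tau k A B V X v x) = f x v := by
  rw [Tens.uncurry, Tens.linear_apply, Tens.lift_tau]
  rfl

/-- By adjunction, extending maps from `V ⊗_B X` to `N` is the same as extending maps from `X` to
`Hom_k(V, N)`. -/
lemma extends_tens_iff {ι : X →ₗ[A ⊗[k] B] P} :
    Extends (Tens.map k A B V ι) N ↔ Extends ι (CoindB k V N) := by
  constructor
  · intro h g
    obtain ⟨f, hf⟩ := h (Tens.uncurry g)
    refine ⟨Tens.curry f, fun x => CoindB.ext fun v => ?_⟩
    rw [Tens.curry_apply, ← Tens.map_tau, hf, Tens.uncurry_tau]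
  · intro h g
    obtain ⟨f, hf⟩ := h (Tens.curry g)
    refine ⟨Tens.uncurry f, Tens.linear_ext (f := Tens.uncurry f ∘ₗ Tens.map k A B V ι)
      fun v x => ?_⟩
    rw [LinearMap.comp_apply, Tens.map_tau, Tens.uncurry_tau, hf, Tens.curry_apply]

/-- The functor `V ⊗_B -` preserves projective modules because its right adjoint `Hom_k(V, -)` is
exact. -/
lemma Tens.projective [Module.Projective (A ⊗[k] B) P] :
    Module.Projective A (Tens k A B V P) := by
  refine Module.Projective.of_lifting_property fun {M N} _ _ _ _ f g hf => ?_
  let := Module.compHom M (algebraMap k A)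
  let := Module.compHom N (algebraMap k A)
  have : IsScalarTower k A M := ⟨fun c a m => by
    rw [Algebra.smul_def, mul_smul]; rfl⟩
  have : IsScalarTower k A N := ⟨fun c a m => by
    rw [Algebra.smul_def, mul_smul]; rfl⟩
  -- postcomposition with `f` is surjective on `Hom_k(V, -)`
  let F : CoindB k V M →ₗ[A ⊗[k] B] CoindB k V N :=
    linearOfTmul (AddMonoidHom.mk' (fun h => CoindB.equiv k V N
      ((f.restrictScalars k).comp ((CoindB.equiv k V M).symm h))) fun h h' =>
        CoindB.ext fun v => f.map_add _ _) fun a b h => CoindB.ext fun v => f.map_smul _ _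
  have hF : Function.Surjective F := fun h => by
    obtain ⟨h', hh'⟩ := exists_lift_of_projective (p := f.restrictScalars k) hf
      ((CoindB.equiv k V N).symm h)
    exact ⟨CoindB.equiv k V M h', CoindB.ext hh'⟩
  obtain ⟨h, hh⟩ := exists_lift_of_projective hF (Tens.curry g)
  refine ⟨Tens.uncurry h, LinearMap.ext (Tens.linear_ext fun v x => ?_)⟩
  rw [LinearMap.comp_apply, Tens.uncurry_tau]
  exact DFunLike.congr_fun (hh x) v

lemma Tens.finite [FiniteDimensional k V] [Module.Finite (A ⊗[k] B) X] :
    Module.Finite A (Tens k A B V X) := by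
  classical
  obtain ⟨s, hs⟩ := Module.Finite.fg_top (R := A ⊗[k] B) (M := X)
  obtain ⟨t, ht⟩ := Module.Finite.fg_top (R := k) (M := V)
  let S := Submodule.span A
    (Finset.image₂ (fun v x => tau k A B V X v x) t s : Set (Tens k A B V X))
  have h1 : ∀ x ∈ s, ∀ v, tau k A B V X v x ∈ S := fun x hx v => by
    have hv : v ∈ Submodule.span k (t : Set V) := ht ▸ Submodule.mem_top
    induction hv using Submodule.span_induction with
    | mem v hv => exact Submodule.subset_span (Finset.mem_coe.2 (Finset.mem_image₂_of_mem hv hx))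
    | zero => simp
    | add v w _ _ hv hw => rw [map_add]; exact S.add_mem hv hw
    | smul c v _ hv => rw [tau_smul]; exact S.smul_mem _ hv
  have h2 : ∀ x v, tau k A B V X v x ∈ S := fun x => by
    have hx : x ∈ Submodule.span (A ⊗[k] B) (s : Set X) := hs ▸ Submodule.mem_top
    induction hx using Submodule.span_induction with
    | mem x hx => exact h1 x hx
    | zero => simp
    | add x y _ _ hx hy => exact fun v => by rw [map_add]; exact S.add_mem (hx v) (hy v)
    | smul r x _ hx =>
      intro v
      induction r using TensorProduct.induction_on with
      | zero => simp
      | add r r' hr hr' => rw [add_smul, map_add]; exact S.add_mem hr hr'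
      | tmul a b => rw [tau_tmul_smul]; exact S.smul_mem _ (hx _)
  refine ⟨⟨Finset.image₂ (fun v x => tau k A B V X v x) t s, eq_top_iff.2 fun z _ => ?_⟩⟩
  change z ∈ S
  induction z using Tens.induction with
  | zero => exact S.zero_mem
  | add y z hy hz => exact S.add_mem (hy trivial) (hz trivial)
  | tau v x => exact h2 x v

end Adjunction

end Coind

/-! ### `Mon(B, A)` consists of the modules that are projective over `B` -/

section Mon

variable {k A B : Type u} [Field k] [Ring A] [Algebra k A] [Ring B] [Algebra k B]

/-- If tensoring with `D(W)` preserves injectivity of `ι : X → P`, then `B`-linear maps `X → W`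
extend along `ι`, because `Hom_B(X, W)` is the `k`-dual of `D(W) ⊗_B X`. -/
lemma extends_res_of_tens_injective (W : Type u) [AddCommGroup W] [Module k W] [Module B W]
    [IsScalarTower k B W] [FiniteDimensional k W] {X P : Type u} [AddCommGroup X]
    [Module (A ⊗[k] B) X] [AddCommGroup P] [Module (A ⊗[k] B) P] {ι : X →ₗ[A ⊗[k] B] P}
    (hι : Function.Injective (Tens.map k A B (D k W) ι)) :
    Extends (Res.map (inclB k A B) ι) W := fun g => by
  obtain ⟨L, hL⟩ := ((Tens.map k A B (D k W) ι).restrictScalars k).exists_leftInverse_of_injective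
    (LinearMap.ker_eq_bot.2 hι)
  -- `l` is the functional `φ ⊗ x ↦ φ (g x)`; `r p` is the element of `W ≅ DDW` given by
  -- `φ ↦ l (L (φ ⊗ p))`
  let l : Tens k A B (D k W) X →+ k := Tens.lift (AddMonoidHom.mk' (fun φ => AddMonoidHom.mk'
    (fun x => φ (g (toRes _ X x))) fun x y => by
      rw [map_add, map_add]
      exact LinearMap.map_add (show W →ₗ[k] k from φ) _ _) fun φ ψ => rfl) fun b φ x => by
    change (MulOpposite.op b • φ) (g (toRes _ X x)) = φ (g (b • toRes _ X x))
    rw [D.op_smul_apply, g.map_smul]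
  have hl : ∀ (φ : D k W) (x : X), l (tau k A B (D k W) X φ x) = φ (g (toRes _ X x)) :=
    fun φ x => Tens.lift_tau _ _ φ x
  have htau : ∀ (Z : Type u) [AddCommGroup Z] [Module (A ⊗[k] B) Z] (c : k) (φ : D k W) (z : Z),
      tau k A B (D k W) Z (c • φ) z = c • tau k A B (D k W) Z φ z := fun Z _ _ c φ z => by
    rw [tau_smul, algebraMap_smul]
  have hlsmul : ∀ (c : k) z, l (c • z) = c • l z := fun c z => by
    induction z using Tens.induction with
    | zero => simp
    | add y z hy hz => rw [smul_add, map_add, hy, hz, map_add, smul_add]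
    | tau φ x => rw [← htau, hl, hl]; rfl
  let r : P → W := fun p => (Module.evalEquiv k W).symm
    { toFun := fun φ => l (L (tau k A B (D k W) P φ p))
      map_add' := fun φ ψ => by
        rw [← map_add l, ← map_add L]
        exact congrArg (fun t => l (L (t p))) (map_add (tau k A B (D k W) P) φ ψ)
      map_smul' := fun c φ => by
        rw [RingHom.id_apply, ← hlsmul, ← map_smul L]
        exact congrArg (fun t => l (L t)) (htau P c φ p) }
  have hr : ∀ p (φ : D k W), φ (r p) = l (L (tau k A B (D k W) P φ p)) := fun p φ =>
    Module.apply_evalEquiv_symm_apply k W (show Module.Dual k W from φ) _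
  have hsep : ∀ w w' : W, (∀ φ : D k W, φ w = φ w') → w = w' := fun w w' h =>
    (Module.evalEquiv k W).injective (LinearMap.ext h)
  refine ⟨
    { toFun := fun p => r ((toRes _ P).symm p)
      map_add' := fun p q => hsep _ _ fun φ => ?_
      map_smul' := fun b p => hsep _ _ fun φ => ?_ }, fun x => hsep _ _ fun φ => ?_⟩
  · rw [hr, map_add, map_add, map_add, map_add, ← hr, ← hr]
    exact (LinearMap.map_add (show W →ₗ[k] k from φ) _ _).symm
  · rw [hr, RingHom.id_apply, ← D.op_smul_apply, hr, tau_op_smul]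
    rfl
  · refine (hr _ φ).trans ?_
    change l (L (tau k A B (D k W) P φ (ι ((toRes _ X).symm x)))) = _
    rw [← Tens.map_tau]
    refine (congrArg l (LinearMap.congr_fun hL _)).trans ?_
    exact hl _ _

/-- Maps to modules of finite length extend if maps to simple modules do. -/
lemma Extends.of_isFiniteLength {X P Y : Type u} [AddCommGroup X] [Module B X] [AddCommGroup P]
    [Module B P] [AddCommGroup Y] [Module B Y] [Module.Projective B P] {ι : X →ₗ[B] P}
    (h : ∀ (S : Type u) [AddCommGroup S] [Module B S] [IsSimpleModule B S], Extends ι S)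
    (hY : IsFiniteLength B Y) : Extends ι Y := by
  induction hY with
  | of_subsingleton => exact fun g => ⟨0, fun x => Subsingleton.elim _ _⟩
  | @of_simple_quotient M _ _ N _ _ ih =>
    intro g
    obtain ⟨u, hu⟩ := h (M ⧸ N) (N.mkQ ∘ₗ g)
    obtain ⟨v, hv⟩ := exists_lift_of_projective N.mkQ_surjective u
    obtain ⟨w, hw⟩ := exists_factor_of_injective N.subtype_injective (g - v ∘ₗ ι) fun x => by
      have : g x - v (ι x) ∈ N := by
        rw [← Submodule.Quotient.mk_eq_zero]
        change N.mkQ (g x - v (ι x)) = 0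
        rw [map_sub, hv, hu]
        simp
      exact ⟨⟨_, this⟩, rfl⟩
    obtain ⟨t, ht⟩ := ih w
    refine ⟨v + N.subtype ∘ₗ t, fun x => ?_⟩
    simp only [LinearMap.add_apply, LinearMap.comp_apply, ht, hw, LinearMap.sub_apply]
    abel

/-- Extending the identity of `X` splits the sequence, so that `Y` is a direct summand of `P`. -/
lemma IsSES.projective_of_extends {R : Type u} [Ring R] {X P Y : Type u} [AddCommGroup X]
    [Module R X] [AddCommGroup P] [Module R P] [AddCommGroup Y] [Module R Y] {ι : X →ₗ[R] P}
    {π : P →ₗ[R] Y} (hs : IsSES ι π) (h : Extends ι X) [Module.Projective R P] :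
    Module.Projective R Y := by
  obtain ⟨r, hr⟩ := h LinearMap.id
  obtain ⟨i, hi⟩ := hs.desc (LinearMap.id - ι ∘ₗ r) fun x => by simp [hr]
  refine Module.Projective.of_split i π (LinearMap.ext fun y => ?_)
  obtain ⟨p, rfl⟩ := hs.surj y
  simp [hi, hs.comp_apply]

/-- Splitting off one step of an exact sequence of projective modules whose cokernel is
projective. -/
lemma exists_homotopy_of_projective {R : Type u} [Ring R] {X₂ X₁ X₀ C : Type u} [AddCommGroup X₂]
    [Module R X₂] [AddCommGroup X₁] [Module R X₁] [AddCommGroup X₀] [Module R X₀] [AddCommGroup C]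
    [Module R C] {f : X₂ →ₗ[R] X₁} {g : X₁ →ₗ[R] X₀} {c : X₀ →ₗ[R] C} (hfg : Function.Exact f g)
    (hgc : Function.Exact g c) (hc : Function.Surjective c) [Module.Projective R X₁]
    [Module.Projective R X₀] [Module.Projective R C] :
    (∃ (s : X₁ →ₗ[R] X₂) (t : X₀ →ₗ[R] X₁), ∀ x, f (s x) + t (g x) = x) ∧
      Module.Projective R (LinearMap.range g) := by
  obtain ⟨σ, hσ⟩ := exists_lift_of_projective hc LinearMap.id
  obtain ⟨ρ, hρ⟩ := exists_factor_of_injective (LinearMap.range g).subtype_injective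
    (LinearMap.id - σ ∘ₗ c) fun x => by
      obtain ⟨y, hy⟩ := (hgc (x - σ (c x))).1 (by simp [hσ])
      exact ⟨⟨_, y, rfl⟩, hy⟩
  have hproj : Module.Projective R (LinearMap.range g) :=
    Module.Projective.of_split (LinearMap.range g).subtype ρ (LinearMap.ext fun z =>
      Subtype.ext <| by
      obtain ⟨_, y, rfl⟩ := z
      exact (hρ (g y)).trans (by simp [hgc.apply_apply_eq_zero]))
  obtain ⟨τ, hτ⟩ := exists_lift_of_projective (p := g.rangeRestrict) g.surjective_rangeRestrict
    LinearMap.id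
  have hgt : ∀ x, g (τ (ρ x)) = x - σ (c x) := fun x =>
    (congrArg Subtype.val (hτ (ρ x))).trans (hρ x)
  obtain ⟨s', hs'⟩ := exists_factor_of_injective (LinearMap.range f).subtype_injective
    (LinearMap.id - τ ∘ₗ ρ ∘ₗ g) fun x => by
      obtain ⟨y, hy⟩ := (hfg (x - τ (ρ (g x)))).1 (by
        rw [map_sub, hgt, hgc.apply_apply_eq_zero]; simp)
      exact ⟨⟨_, y, rfl⟩, hy⟩
  obtain ⟨s, hs⟩ := exists_lift_of_projective (p := f.rangeRestrict) f.surjective_rangeRestrict s'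
  refine ⟨⟨s, τ ∘ₗ ρ, fun x => ?_⟩, hproj⟩
  have : f (s x) = x - τ (ρ (g x)) := (congrArg Subtype.val (hs x)).trans (hs' x)
  rw [this]
  simp

section Tor

variable {R Γ : Type u} [Ring R] [Ring Γ] {M : Type u} [AddCommGroup M] [Module R M]
  [Module Γᵐᵒᵖ M] [SMulCommClass R Γᵐᵒᵖ M] {X : ModuleCat.{u} Γ}

/-- Vanishing of `Tor`, read off from a projective resolution by elements. -/
lemma isZero_tor_succ_iff (P : ProjectiveResolution X) (n : ℕ) :
    Limits.IsZero (Tor R Γ M (n + 1) X) ↔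
      Function.Exact (BalancedTensor.map R Γ M (P.complex.d (n + 2) (n + 1)).hom)
        (BalancedTensor.map R Γ M (P.complex.d (n + 1) n).hom) := by
  rw [Tor, (P.isoLeftDerivedObj (tensorFunctor R Γ M) (n + 1)).isZero_iff]
  change Limits.IsZero (HomologicalComplex.homology _ (n + 1)) ↔ _
  rw [← HomologicalComplex.exactAt_iff_isZero_homology,
    HomologicalComplex.exactAt_iff' _ (n + 2) (n + 1) n (by simp only [ChainComplex.prev]; rfl)
      (by simp), ShortComplex.ShortExact.moduleCat_exact_iff_function_exact]
  rfl

lemma resolution_exact (P : ProjectiveResolution X) (n : ℕ) :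
    Function.Exact (P.complex.d (n + 2) (n + 1)).hom (P.complex.d (n + 1) n).hom :=
  (ShortComplex.ShortExact.moduleCat_exact_iff_function_exact _).1 (P.exact_succ n)

lemma resolution_augmentation (P : ProjectiveResolution X) :
    ∃ π : P.complex.X 0 →ₗ[Γ] X, Function.Surjective π ∧
      Function.Exact (P.complex.d 1 0).hom π :=
  ⟨(P.π.f 0).hom, (ModuleCat.epi_iff_surjective (P.π.f 0)).1 inferInstance,
    (ShortComplex.ShortExact.moduleCat_exact_iff_function_exact _).1 P.exact₀⟩

lemma resolution_projective (P : ProjectiveResolution X) (n : ℕ) :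
    Module.Projective Γ (P.complex.X n) :=
  (IsProjective.iff_projective (R := Γ) (P.complex.X n)).2 (P.projective n)

end Tor

/-- A projective resolution of a module that is projective over `B` is split exact over `B`, so it
stays exact under `V ⊗_B -`. -/
lemma isZero_tor_of_projective [FiniteDimensional k A] (V : Type u) [AddCommGroup V] [Module k V]
    [Module Bᵐᵒᵖ V] [IsScalarTower k Bᵐᵒᵖ V] {X : ModuleCat.{u} (A ⊗[k] B)}
    (hX : Module.Projective B (Res (inclB k A B) X)) (n : ℕ) :
    Limits.IsZero (Tor A (A ⊗[k] B) (A ⊗[k] V) (n + 1) X) := by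
  let P : ProjectiveResolution X := ProjectiveResolution.of X
  have hP : ∀ n, Module.Projective B (Res (inclB k A B) (P.complex.X n)) := fun n =>
    have := resolution_projective P n
    Res.projective (inclB k A B) (projective_res_inclB k A B)
  -- over `B`, all cokernels in the resolution are projective
  have key : ∀ n, ∃ (C : ModuleCat.{u} B) (c : Res (inclB k A B) (P.complex.X n) →ₗ[B] C),
      Module.Projective B C ∧ Function.Surjective c ∧
      Function.Exact (Res.map (inclB k A B) (P.complex.d (n + 1) n).hom) c := fun n => by
    induction n with
    | zero =>
      obtain ⟨π, hπ, he⟩ := resolution_augmentation P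
      let π' : Res (inclB k A B) (P.complex.X 0) →ₗ[B] Res (inclB k A B) X := Res.map _ π
      exact ⟨ModuleCat.of B (Res (inclB k A B) X), π', hX, hπ, exact_res _ he⟩
    | succ n ih =>
      obtain ⟨C, c, hC, hc, he⟩ := ih
      obtain ⟨-, h⟩ := exists_homotopy_of_projective
        (exact_res (inclB k A B) (resolution_exact P n)) he hc
      refine ⟨ModuleCat.of B (LinearMap.range (Res.map (inclB k A B) (P.complex.d (n + 1) n).hom)),
        LinearMap.rangeRestrict _, h, LinearMap.surjective_rangeRestrict _, fun x => ?_⟩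
      rw [Subtype.ext_iff]
      exact resolution_exact P n x
  rw [isZero_tor_succ_iff P]
  obtain ⟨C, c, hC, hc, he⟩ := key n
  obtain ⟨⟨s, t, hst⟩, -⟩ := exists_homotopy_of_projective
    (exact_res (inclB k A B) (resolution_exact P n)) he hc
  exact Tens.exact_of_homotopy (fun x => (resolution_exact P n).apply_apply_eq_zero x) s t hst

lemma isFiniteLength_of_finite [FiniteDimensional k B] (Y : Type u) [AddCommGroup Y] [Module B Y]
    [Module.Finite B Y] : IsFiniteLength B Y := by
  have : IsArtinianRing B := IsArtinianRing.of_finite k B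
  have : IsNoetherianRing B := IsNoetherianRing.of_finite k B
  exact isFiniteLength_iff_isNoetherian_isArtinian.2 ⟨inferInstance, inferInstance⟩

/-- If `Tor_1(DS, X) = 0`, then `B`-linear maps from the first syzygy of `X` to `S` extend, that is,
`Ext^1_B(X, S) = 0`. -/
lemma extends_of_isZero_tor [FiniteDimensional k A] [FiniteDimensional k B]
    {X : ModuleCat.{u} (A ⊗[k] B)} (P : ProjectiveResolution X)
    (S : Type u) [AddCommGroup S] [Module k S] [Module B S] [IsScalarTower k B S]
    [FiniteDimensional k S] (h : Limits.IsZero (Tor A (A ⊗[k] B) (A ⊗[k] D k S) 1 X))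
    {π : P.complex.X 0 →ₗ[A ⊗[k] B] X} (he : Function.Exact (P.complex.d 1 0).hom π) :
    Extends (Res.map (inclB k A B) (LinearMap.ker π).subtype) S := by
  refine extends_res_of_tens_injective S ((injective_iff_map_eq_zero _).2 fun z hz => ?_)
  let q : P.complex.X 1 →ₗ[A ⊗[k] B] LinearMap.ker π :=
    (P.complex.d 1 0).hom.codRestrict _ fun x => he.apply_apply_eq_zero x
  have hq : Function.Surjective q := fun ⟨y, hy⟩ => by
    obtain ⟨x, rfl⟩ := (he y).1 hy
    exact ⟨x, rfl⟩
  obtain ⟨w, rfl⟩ := Tens.map_surjective (V := D k S) hq z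
  have hcomp : ∀ w, Tens.map k A B (D k S) (LinearMap.ker π).subtype
      (Tens.map k A B (D k S) q w) = Tens.map k A B (D k S) (P.complex.d 1 0).hom w := fun w => by
    induction w using Tens.induction with
    | zero => simp
    | add y z hy hz => simp only [map_add, hy, hz]
    | tau v x => rfl
  rw [hcomp] at hz
  obtain ⟨w', rfl⟩ := ((isZero_tor_succ_iff P 0).1 h w).1 hz
  have hq0 : ∀ w, Tens.map k A B (D k S) q
      (Tens.map k A B (D k S) (P.complex.d 2 1).hom w) = 0 := fun w => by
    induction w using Tens.induction with
    | zero => simp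
    | add y z hy hz => rw [map_add, map_add, hy, hz, add_zero]
    | tau v x =>
      rw [Tens.map_tau, Tens.map_tau]
      have : q ((P.complex.d 2 1).hom x) = 0 :=
        Subtype.ext ((resolution_exact P 0).apply_apply_eq_zero x)
      rw [this, map_zero]
  exact hq0 w'

/-- `Mon(B, A)` is the class of finitely generated modules that are projective over `B`: if
`Ext^1_B(X, S) = 0` for all simple `S`, then `Ext^1_B(X, -)` vanishes on all modules of finite
length, in particular on the first syzygy of `X`. -/
theorem mon_iff [FiniteDimensional k A] [FiniteDimensional k B] (X : ModuleCat.{u} (A ⊗[k] B)) :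
    Mon k A B X ↔ Module.Finite (A ⊗[k] B) X ∧ Module.Projective B (Res (inclB k A B) X) := by
  refine ⟨fun ⟨hfin, h⟩ => ⟨hfin, ?_⟩, fun ⟨hfin, h⟩ => ⟨hfin, fun S _ _ _ _ _ i hi => ?_⟩⟩
  · let P : ProjectiveResolution X := ProjectiveResolution.of X
    obtain ⟨π, hπ, he⟩ := resolution_augmentation P
    have := resolution_projective P 0
    have : Module.Projective B (Res (inclB k A B) (P.complex.X 0)) :=
      Res.projective (inclB k A B) (projective_res_inclB k A B)
    have h1 : ∀ (S : Type u) [AddCommGroup S] [Module B S] [IsSimpleModule B S],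
        Extends (Res.map (inclB k A B) (LinearMap.ker π).subtype) S := fun S _ _ _ => by
      let := Module.compHom S (algebraMap k B)
      have : IsScalarTower k B S := ⟨fun c b s => by rw [Algebra.smul_def, mul_smul]; rfl⟩
      have : FiniteDimensional k S := Module.Finite.trans B S
      exact extends_of_isZero_tor P S (h S 1 le_rfl) he
    have : IsNoetherianRing (A ⊗[k] B) := IsNoetherianRing.of_finite k _
    obtain ⟨K, Q, ι, ρ, hK, ⟨hQ, hQ'⟩, hs⟩ := exists_presentation (Γ := A ⊗[k] B) X
    have : Module.Finite B (Res (inclB k A B) K) :=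
      Res.finite (inclB k A B) (finite_res_inclB k A B)
    have : Module.Projective B (Res (inclB k A B) Q) :=
      Res.projective (inclB k A B) (projective_res_inclB k A B)
    exact (hs.res (inclB k A B)).projective_of_extends
      (Extends.of_presentation ((IsSES.ker_subtype hπ).res (inclB k A B))
        (Extends.of_isFiniteLength h1 (isFiniteLength_of_finite (k := k) _))
        (hs.res (inclB k A B)))
  · obtain ⟨n, rfl⟩ : ∃ n, i = n + 1 := ⟨i - 1, by lia⟩
    exact isZero_tor_of_projective _ h n

end Mon

/-! ### Injective right modules over a finite dimensional algebra -/

section Dual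

variable (k R : Type u) [Field k] [Ring R] [Algebra k R]

/-- The coefficients of the orbit maps `a ↦ n a` with respect to a `k`-basis embed a right module
`N` into a power of `DR`. -/
lemma exists_embedding (N : Type u) [AddCommGroup N] [Module k N] [Module Rᵐᵒᵖ N]
    [IsScalarTower k Rᵐᵒᵖ N] [FiniteDimensional k N] :
    ∃ (n : ℕ) (j : N →ₗ[Rᵐᵒᵖ] (Fin n → D k R)), Function.Injective j := by
  let e := Module.finBasis k N
  let orbit (x : N) : R →ₗ[k] N :=
    { toFun := fun a => MulOpposite.op a • x
      map_add' := fun a b => by rw [MulOpposite.op_add, add_smul]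
      map_smul' := fun c a => by rw [MulOpposite.op_smul, smul_assoc, RingHom.id_apply] }
  let j : N → (Fin (Module.finrank k N) → D k R) := fun x i =>
    show Module.Dual k R from e.coord i ∘ₗ orbit x
  have hj : ∀ x i a, j x i a = e.coord i (MulOpposite.op a • x) := fun x i a => rfl
  have hadd : ∀ (φ ψ : D k R) a, (φ + ψ) a = φ a + ψ a := fun _ _ _ => rfl
  refine ⟨_, { toFun := j, map_add' := fun x y => ?_, map_smul' := fun b x => ?_ },
    fun x y hxy => e.ext_elem fun i => ?_⟩
  · ext i a
    rw [Pi.add_apply, hadd, hj, hj, hj, smul_add, map_add]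
  · ext i a
    obtain ⟨b, rfl⟩ := MulOpposite.op_surjective b
    rw [RingHom.id_apply, Pi.smul_apply, D.op_smul_apply, hj, hj, smul_smul, smul_eq_mul,
      MulOpposite.op_mul]
  · have := DFunLike.congr_fun (congrFun hxy i) (1 : R)
    change j x i 1 = j y i 1 at this
    rw [hj, hj] at this
    simpa using this

lemma injective_pi_dual (n : ℕ) : Module.Injective Rᵐᵒᵖ (Fin n → D k R) := by
  refine ⟨fun X Y _ _ _ _ f hf g => ?_⟩
  let := Module.compHom X (algebraMap k Rᵐᵒᵖ)
  let := Module.compHom Y (algebraMap k Rᵐᵒᵖ)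
  have : IsScalarTower k Rᵐᵒᵖ X := ⟨fun c a m => by rw [Algebra.smul_def, mul_smul]; rfl⟩
  have : IsScalarTower k Rᵐᵒᵖ Y := ⟨fun c a m => by rw [Algebra.smul_def, mul_smul]; rfl⟩
  obtain ⟨L, hL⟩ := (f.restrictScalars k).exists_leftInverse_of_injective
    (LinearMap.ker_eq_bot.2 hf)
  have hadd : ∀ (φ ψ : D k R) a, (φ + ψ) a = φ a + ψ a := fun _ _ _ => rfl
  have hsmul : ∀ (c : k) (φ : D k R) a, (c • φ) a = c • φ a := fun _ _ _ => rfl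
  -- evaluation of the coordinates of `g` at `1` determines `g`
  let l (i : Fin n) : X →ₗ[k] k :=
    { toFun := fun x => g x i 1
      map_add' := fun x y => by rw [map_add, Pi.add_apply, hadd]
      map_smul' := fun c x => by
        rw [← algebraMap_smul Rᵐᵒᵖ c x, map_smul, algebraMap_smul, Pi.smul_apply, hsmul,
          RingHom.id_apply] }
  let orbit (y : Y) : R →ₗ[k] Y :=
    { toFun := fun a => MulOpposite.op a • y
      map_add' := fun a b => by rw [MulOpposite.op_add, add_smul]
      map_smul' := fun c a => by rw [MulOpposite.op_smul, smul_assoc, RingHom.id_apply] }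
  let h : Y → (Fin n → D k R) := fun y i => show Module.Dual k R from l i ∘ₗ L ∘ₗ orbit y
  have hh : ∀ y i a, h y i a = g (L (MulOpposite.op a • y)) i 1 := fun _ _ _ => rfl
  refine ⟨{ toFun := h, map_add' := fun x y => ?_, map_smul' := fun b x => ?_ }, fun x => ?_⟩
  · ext i a
    rw [Pi.add_apply, hadd, hh, hh, hh, smul_add, map_add, map_add, Pi.add_apply, hadd]
  · ext i a
    obtain ⟨b, rfl⟩ := MulOpposite.op_surjective b
    rw [RingHom.id_apply, Pi.smul_apply, D.op_smul_apply, hh, hh, smul_smul, smul_eq_mul,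
      MulOpposite.op_mul]
  · ext i a
    change h (f x) i a = g x i a
    rw [hh, ← map_smul]
    have : L (f (MulOpposite.op a • x)) = MulOpposite.op a • x := LinearMap.congr_fun hL _
    rw [this, map_smul, Pi.smul_apply, D.op_smul_apply, smul_eq_mul, mul_one]

end Dual

/-! ### Restricting Gorenstein projective `A ⊗ B`-modules to `B` -/

section Restrict

variable {k A B : Type u} [Field k] [Ring A] [Algebra k A] [Ring B] [Algebra k B]

/-- The contravariant functor `Hom_k(-, B)` is exact. -/
lemma IsSES.coindA {N I Q : Type u} [AddCommGroup N] [Module k N] [Module Aᵐᵒᵖ N]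
    [IsScalarTower k Aᵐᵒᵖ N] [AddCommGroup I] [Module k I] [Module Aᵐᵒᵖ I]
    [IsScalarTower k Aᵐᵒᵖ I] [AddCommGroup Q] [Module k Q] [Module Aᵐᵒᵖ Q]
    [IsScalarTower k Aᵐᵒᵖ Q] {j : N →ₗ[Aᵐᵒᵖ] I} {q : I →ₗ[Aᵐᵒᵖ] Q} (h : IsSES j q) :
    IsSES (CoindA.comap (k := k) B q) (CoindA.comap (k := k) B j) := by
  refine ⟨fun f g hfg => CoindA.ext fun x => ?_, fun f => ⟨fun hf => ?_, ?_⟩, fun f => ?_⟩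
  · obtain ⟨y, rfl⟩ := h.surj x
    exact DFunLike.congr_fun hfg y
  · obtain ⟨g, hg⟩ := exists_factor_of_surjective (p := q.restrictScalars k) h.surj
      ((CoindA.equiv k B I).symm f) fun y hy => by
        obtain ⟨x, rfl⟩ := h.exists_of_eq_zero hy
        exact DFunLike.congr_fun hf x
    exact ⟨CoindA.equiv k B Q g, CoindA.ext hg⟩
  · rintro ⟨g, rfl⟩
    refine CoindA.ext fun x => ?_
    rw [CoindA.comap_apply, CoindA.comap_apply, h.comp_apply, map_zero]
    rfl
  · obtain ⟨r, hr⟩ := (j.restrictScalars k).exists_leftInverse_of_injective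
      (LinearMap.ker_eq_bot.2 h.inj)
    exact ⟨CoindA.equiv k B I ((CoindA.equiv k B N).symm f ∘ₗ r), CoindA.ext fun x =>
      congrArg f (LinearMap.congr_fun hr x)⟩

/-- For a right `A`-module `N` of finite injective dimension, all Gorenstein projective
`A ⊗ B`-modules are Ext-orthogonal to `Hom_k(N, B)`: an injective coresolution of `N` is turned into
a finite resolution of `Hom_k(N, B)` by projective modules. -/
lemma perp_coindA [FiniteDimensional k A] (n : ℕ) (N : Type u) [AddCommGroup N] [Module k N]
    [Module Aᵐᵒᵖ N] [IsScalarTower k Aᵐᵒᵖ N] [FiniteDimensional k N]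
    (hN : HasInjectiveDimensionLE (ModuleCat.of Aᵐᵒᵖ N) n) {Y : ModuleCat.{u} (A ⊗[k] B)}
    (hY : Gproj (A ⊗[k] B) Y) : Perp (A ⊗[k] B) (CoindA k B N) Y := by
  -- orthogonality to `L` follows if maps to `L` extend whenever maps to `A ⊗ B` do
  have key : ∀ (L : Type u) [AddCommGroup L] [Module (A ⊗[k] B) L], (∀ (X P : Type u)
      [AddCommGroup X] [Module (A ⊗[k] B) X] [AddCommGroup P] [Module (A ⊗[k] B) P]
      (ι : X →ₗ[A ⊗[k] B] P), Extends ι (A ⊗[k] B) → Extends ι L) →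
      Perp (A ⊗[k] B) L Y := fun L _ _ hL =>
    perp_of_left_class (Gproj (A ⊗[k] B)) (fun Y hY => by
      obtain ⟨X, hX, P, ι, π, hP, hs, he⟩ := hY.exists_left
      exact ⟨X, P, ι, π, hX, hP.2, hs, hL _ _ ι he⟩) hY
  induction n generalizing N with
  | zero =>
    obtain ⟨m, j, hj⟩ := exists_embedding k A N
    have hinj : Injective (ModuleCat.of Aᵐᵒᵖ N) := injective_iff_hasInjectiveDimensionLT_one.2 hN
    have := Module.injective_module_of_injective_object Aᵐᵒᵖ N
    obtain ⟨r, hr⟩ := Module.Injective.out j hj (LinearMap.id : N →ₗ[Aᵐᵒᵖ] N)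
    exact key _ fun X P _ _ _ _ ι he => (he.coindA (Fin m)).retract (CoindA.comap B r)
      (CoindA.comap B j) fun f => CoindA.ext fun x => congrArg f (hr x)
  | succ n ih =>
    obtain ⟨m, j, hj⟩ := exists_embedding k A N
    have hs := IsSES.range_mkQ hj
    have := injective_pi_dual k A m
    have hI : Injective (ModuleCat.of Aᵐᵒᵖ (Fin m → D k A)) :=
      Module.injective_object_of_injective_module Aᵐᵒᵖ _
    have : FiniteDimensional k (D k A) := inferInstanceAs (FiniteDimensional k (Module.Dual k A))
    have : FiniteDimensional k ((Fin m → D k A) ⧸ LinearMap.range j) :=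
      Module.Finite.of_surjective ((LinearMap.range j).mkQ.restrictScalars k)
        (LinearMap.range j).mkQ_surjective
    exact Perp.coefficients (hs.coindA (B := B))
      (ih ((Fin m → D k A) ⧸ LinearMap.range j)
        ((hs.shortExact.hasInjectiveDimensionLT_X₃_iff n hI).2 hN))
      (key _ fun X P _ _ _ _ ι he => he.coindA (Fin m))

/-- The module `Hom_k(A, B)` is coinduced from `B`: maps `X → Hom_k(A, B)` over `A ⊗ B` are
`B`-linear maps `X → B`. -/
lemma Extends.res_of_coindA {X P : Type u} [AddCommGroup X] [Module (A ⊗[k] B) X] [AddCommGroup P]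
    [Module (A ⊗[k] B) P] {ι : X →ₗ[A ⊗[k] B] P} (h : Extends ι (CoindA k B A)) :
    Extends (Res.map (inclB k A B) ι) B := fun g => by
  have hg : ∀ (b : B) (x : X), g (toRes _ X (((1 : A) ⊗ₜ[k] b) • x)) = b * g (toRes _ X x) :=
    fun b x => g.map_smul b (toRes _ X x)
  obtain ⟨H, hH⟩ := h (linearOfTmul (AddMonoidHom.mk' (fun x => CoindA.equiv k B A
    { toFun := fun a => g (toRes _ X ((a ⊗ₜ[k] (1 : B)) • x))
      map_add' := fun a b => by rw [TensorProduct.add_tmul, add_smul, map_add, map_add]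
      map_smul' := fun c a => by
        rw [RingHom.id_apply, Algebra.smul_def, Algebra.smul_def, ← hg, smul_smul,
          Algebra.TensorProduct.tmul_mul_tmul, one_mul, mul_one, Algebra.algebraMap_eq_smul_one,
          Algebra.algebraMap_eq_smul_one, smul_mul_assoc, one_mul, TensorProduct.smul_tmul] })
    fun x y => CoindA.ext fun a => by
      simp [CoindA.equiv_apply, CoindA.add_apply]) fun a b x => CoindA.ext fun a' => by
      change g (toRes _ X ((a' ⊗ₜ[k] (1 : B)) • (a ⊗ₜ[k] b) • x)) =
        b * g (toRes _ X (((a' * a) ⊗ₜ[k] (1 : B)) • x))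
      rw [← hg, smul_smul, smul_smul, Algebra.TensorProduct.tmul_mul_tmul,
        Algebra.TensorProduct.tmul_mul_tmul, one_mul, one_mul, mul_one])
  refine ⟨{ toFun := fun p => H ((toRes _ P).symm p) 1
            map_add' := fun p q => by rw [map_add, map_add, CoindA.add_apply]
            map_smul' := fun b p => ?_ }, fun x => ?_⟩
  · change H (((1 : A) ⊗ₜ[k] b) • (toRes _ P).symm p) 1 = _
    rw [map_smul, CoindA.tmul_smul_apply]
    simp
  · change H (ι ((toRes _ X).symm x)) 1 = _
    rw [hH]
    change g (toRes _ X (((1 : A) ⊗ₜ[k] (1 : B)) • (toRes _ X).symm x)) = _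
    rw [← Algebra.TensorProduct.one_def, one_smul, AddEquiv.apply_symm_apply]

/-- If the right module `A` has finite injective dimension, then Gorenstein projective
`A ⊗ B`-modules are Gorenstein projective over `B`. -/
theorem gproj_res [FiniteDimensional k A] {n : ℕ}
    (hA : HasInjectiveDimensionLE (ModuleCat.of Aᵐᵒᵖ A) n) {X : ModuleCat.{u} (A ⊗[k] B)}
    (hX : Gproj (A ⊗[k] B) X) : Gproj B (ModuleCat.of B (Res (inclB k A B) X)) := by
  have hstep : ∀ X Y : ModuleCat.{u} (A ⊗[k] B), Gproj _ Y → Step X Y →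
      Step (ModuleCat.of B (Res (inclB k A B) X)) (ModuleCat.of B (Res (inclB k A B) Y)) := by
    rintro X Y hY ⟨P, ι, π, ⟨hP, hP'⟩, hs, -⟩
    let ι' : Res (inclB k A B) X →ₗ[B] Res (inclB k A B) P := Res.map _ ι
    let π' : Res (inclB k A B) P →ₗ[B] Res (inclB k A B) Y := Res.map _ π
    exact ⟨ModuleCat.of B (Res (inclB k A B) P), ι', π',
      ⟨Res.finite (inclB k A B) (X := P) (finite_res_inclB k A B),
        Res.projective (inclB k A B) (X := P) (projective_res_inclB k A B)⟩,
      hs.res _, ((perp_coindA n A hA hY).extends hs).res_of_coindA⟩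
  refine gproj_of_class (fun Z => ∃ X : ModuleCat.{u} (A ⊗[k] B), Gproj _ X ∧
    Z = ModuleCat.of B (Res (inclB k A B) X)) ?_ ?_ ?_ ⟨X, hX, rfl⟩
  · rintro _ ⟨X, hX, rfl⟩
    have := hX.finite
    exact Res.finite (inclB k A B) (X := X) (finite_res_inclB k A B)
  · rintro _ ⟨X, hX, rfl⟩
    obtain ⟨Y, hY, h⟩ := hX.exists_left
    exact ⟨_, ⟨Y, hY, rfl⟩, hstep _ _ hX h⟩
  · rintro _ ⟨X, hX, rfl⟩
    obtain ⟨Y, hY, h⟩ := hX.exists_right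
    exact ⟨_, ⟨Y, hY, rfl⟩, hstep _ _ hY h⟩

/-- If `A` is Gorenstein and `B` is CM-free, then Gorenstein projective `A ⊗ B`-modules belong to
the monomorphism category of the Gorenstein projective `A`-modules. -/
theorem gproj_le_monIn [FiniteDimensional k A] [FiniteDimensional k B] (hA : IsGorenstein A)
    (hB : IsCMFree B) : Gproj (A ⊗[k] B) ≤ MonIn k A B (Gproj A) := fun X hX => by
  obtain ⟨⟨m, hm⟩, n, hn⟩ := hA
  have hproj : ∀ X, Gproj (A ⊗[k] B) X → Module.Projective B (Res (inclB k A B) X) := fun X hX =>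
    (show Proj B (ModuleCat.of B (Res (inclB k A B) X)) from hB ▸ gproj_res hn hX).2
  refine ⟨(mon_iff X).2 ⟨hX.finite, hproj X hX⟩, fun V _ _ _ _ _ => ?_⟩
  have : FiniteDimensional k V := Module.Finite.trans Bᵐᵒᵖ V
  have : IsNoetherianRing A := IsNoetherianRing.of_finite k A
  have hr : ∀ Z : ModuleCat.{u} A, (∃ X : ModuleCat.{u} (A ⊗[k] B), Gproj _ X ∧
      Z = ModuleCat.of A (Tens k A B V X)) → ∃ (P Y : ModuleCat.{u} A) (ι : Z →ₗ[A] P)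
      (π : P →ₗ[A] Y), (∃ X : ModuleCat.{u} (A ⊗[k] B), Gproj _ X ∧
      Y = ModuleCat.of A (Tens k A B V X)) ∧ Proj A P ∧ IsSES ι π := by
    rintro _ ⟨X, hX, rfl⟩
    obtain ⟨Y, hY, P, ι, π, ⟨hP, hP'⟩, hs, -⟩ := hX.exists_right
    have := hproj Y hY
    exact ⟨ModuleCat.of A (Tens k A B V P), _, Tens.map k A B V ι, Tens.map k A B V π,
      ⟨Y, hY, rfl⟩, ⟨Tens.finite, Tens.projective⟩, hs.tens⟩
  refine gproj_of_perp_class (fun Z => ∃ X : ModuleCat.{u} (A ⊗[k] B), Gproj _ X ∧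
    Z = ModuleCat.of A (Tens k A B V X)) ?_ (fun Z hZ => ?_) hr ⟨X, hX, rfl⟩
  · rintro _ ⟨X, hX, rfl⟩
    have := hX.finite
    exact Tens.finite
  · exact perp_of_right_class _ (fun Z hZ => by
      obtain ⟨P, Y, ι, π, hY, hP, hs⟩ := hr Z hZ
      exact ⟨P, Y, ι, π, hY, hP.2, hs⟩) hm hZ

end Restrict

/-! ### The monomorphism category lies in the Gorenstein projective modules -/

section MonGproj

variable {k A B : Type u} [Field k] [Ring A] [Algebra k A] [Ring B] [Algebra k B]

lemma IsSES.projective_kernel {R : Type u} [Ring R] {X P Y : Type u} [AddCommGroup X]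
    [Module R X] [AddCommGroup P] [Module R P] [AddCommGroup Y] [Module R Y] {ι : X →ₗ[R] P}
    {π : P →ₗ[R] Y} (hs : IsSES ι π) [Module.Projective R P] [Module.Projective R Y] :
    Module.Projective R X := by
  obtain ⟨s, hs'⟩ := exists_lift_of_projective hs.surj LinearMap.id
  obtain ⟨r, hr⟩ := hs.lift (LinearMap.id - s ∘ₗ π) fun p => by simp [hs']
  exact Module.Projective.of_split ι r (LinearMap.ext fun x => hs.inj (by
    rw [LinearMap.comp_apply, hr]; simp [hs.comp_apply]))

/-- The functor `- ⊗_B X` is exact for `X` projective over `B`. -/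
lemma IsSES.tens_left {V W U : Type u} [AddCommGroup V] [Module k V] [Module Bᵐᵒᵖ V]
    [IsScalarTower k Bᵐᵒᵖ V] [AddCommGroup W] [Module k W] [Module Bᵐᵒᵖ W]
    [IsScalarTower k Bᵐᵒᵖ W] [AddCommGroup U] [Module k U] [Module Bᵐᵒᵖ U]
    [IsScalarTower k Bᵐᵒᵖ U] {j : V →ₗ[Bᵐᵒᵖ] W} {ρ : W →ₗ[Bᵐᵒᵖ] U} (h : IsSES j ρ) (X : Type u)
    [AddCommGroup X] [Module (A ⊗[k] B) X] [Module.Projective B (Res (inclB k A B) X)] :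
    IsSES (Tens.mapLeft k A X j) (Tens.mapLeft k A X ρ) := by
  refine ⟨Tens.mapLeft_injective h.inj, fun z => ⟨fun hz => ?_, ?_⟩, fun z => ?_⟩
  · let Q := Tens k A B W X ⧸ LinearMap.range (Tens.mapLeft k A X j)
    let q : Tens k A B W X →ₗ[A] Q := (LinearMap.range (Tens.mapLeft k A X j)).mkQ
    have hq : ∀ w w', ρ w = ρ w' → ∀ x, q (tau k A B W X w x) = q (tau k A B W X w' x) :=
      fun w w' hw x => by
        obtain ⟨v, hv⟩ := h.exists_of_eq_zero (p := w - w') (by rw [map_sub, hw, sub_self])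
        refine (Submodule.Quotient.eq _).2 ⟨tau k A B V X v x, ?_⟩
        rw [Tens.mapLeft_tau, hv, map_sub, AddMonoidHom.sub_apply]
    -- an inverse of the map from the cokernel of `V ⊗ X → W ⊗ X` to `U ⊗ X`
    let s := Function.surjInv h.surj
    have hs : ∀ u, ρ (s u) = u := Function.surjInv_eq h.surj
    let g : Tens k A B U X →+ Q := Tens.lift (AddMonoidHom.mk' (fun u => AddMonoidHom.mk'
        (fun x => q (tau k A B W X (s u) x)) fun x y => by rw [map_add, map_add])
        fun u u' => AddMonoidHom.ext fun x => by
          change q _ = q _ + q _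
          rw [← map_add, ← AddMonoidHom.add_apply, ← map_add]
          exact hq _ _ (by rw [map_add, hs, hs, hs]) x) fun b u x => by
      change q (tau k A B W X (s (MulOpposite.op b • u)) x) =
        q (tau k A B W X (s u) (((1 : A) ⊗ₜ[k] b) • x))
      rw [← tau_op_smul]
      exact hq _ _ (by rw [map_smul, hs, hs]) x
    have hg : ∀ z, g (Tens.mapLeft k A X ρ z) = q z := fun z => by
      induction z using Tens.induction with
      | zero => simp
      | add y z hy hz => simp only [map_add, hy, hz]
      | tau w x =>
        rw [Tens.mapLeft_tau, Tens.lift_tau]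
        exact hq _ _ (hs _) x
    have : q z = 0 := by rw [← hg, hz, map_zero]
    exact (Submodule.Quotient.mk_eq_zero _).1 this
  · rintro ⟨y, rfl⟩
    induction y using Tens.induction with
    | zero => simp
    | add y z hy hz => rw [map_add, map_add, hy, hz, add_zero]
    | tau v x => rw [Tens.mapLeft_tau, Tens.mapLeft_tau, h.comp_apply]; simp
  · induction z using Tens.induction with
    | zero => exact ⟨0, map_zero _⟩
    | add y z hy hz =>
      obtain ⟨y, rfl⟩ := hy
      obtain ⟨z, rfl⟩ := hz
      exact ⟨y + z, map_add _ _ _⟩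
    | tau u x =>
      obtain ⟨w, rfl⟩ := h.surj u
      exact ⟨tau k A B W X w x, Tens.mapLeft_tau _ _ _⟩

/-- Over a finite dimensional algebra every finitely generated module has a left approximation by a
finitely generated free module: finitely many maps span `Hom(X, Γ)` over `k`. -/
lemma exists_extends_pi {Γ : Type u} [Ring Γ] [Algebra k Γ] [FiniteDimensional k Γ] (X : Type u)
    [AddCommGroup X] [Module Γ X] [Module.Finite Γ X] :
    ∃ (n : ℕ) (ι : X →ₗ[Γ] (Fin n → Γ)), Extends ι Γ := by
  obtain ⟨m, s, hs⟩ := Module.Finite.exists_fin (R := Γ) (M := X)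
  let ev : (X →ₗ[Γ] Γ) →ₗ[k] (Fin m → Γ) :=
    { toFun := fun f i => f (s i)
      map_add' := fun f g => rfl
      map_smul' := fun c f => rfl }
  have hev : Function.Injective ev := fun f g hfg => by
    refine LinearMap.ext_on hs ?_
    rintro _ ⟨i, rfl⟩
    exact congrFun hfg i
  have : Module.Finite k (X →ₗ[Γ] Γ) := Module.Finite.of_injective ev hev
  obtain ⟨n, f, hf⟩ := Module.Finite.exists_fin (R := k) (M := X →ₗ[Γ] Γ)
  refine ⟨n, LinearMap.pi f, fun g => ?_⟩
  obtain ⟨c, rfl⟩ := (Submodule.mem_span_range_iff_exists_fun k).1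
    (hf ▸ Submodule.mem_top : g ∈ Submodule.span k (Set.range f))
  exact ⟨∑ i, c i • LinearMap.proj i, fun x => by simp⟩

/-- If `X` is projective over `B` and all `V ⊗_B X` are Gorenstein projective, then a left
approximation of `X` by projective modules induces left approximations of all `V ⊗_B X`. For
`V = DB` this holds by adjunction, and in general `V` embeds into a power of `DB`. -/
lemma extends_tens [FiniteDimensional k B] {X P : Type u} [AddCommGroup X] [Module (A ⊗[k] B) X]
    [AddCommGroup P] [Module (A ⊗[k] B) P] [Module.Projective B (Res (inclB k A B) X)]
    (hX : ∀ (V : Type u) [AddCommGroup V] [Module k V] [Module Bᵐᵒᵖ V] [IsScalarTower k Bᵐᵒᵖ V]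
      [Module.Finite Bᵐᵒᵖ V], Gproj A (ModuleCat.of A (Tens k A B V X)))
    {ι : X →ₗ[A ⊗[k] B] P} (hι : Extends ι (A ⊗[k] B)) (V : Type u) [AddCommGroup V] [Module k V]
    [Module Bᵐᵒᵖ V] [IsScalarTower k Bᵐᵒᵖ V] [Module.Finite Bᵐᵒᵖ V] :
    Extends (Tens.map k A B V ι) A := fun g => by
  have : FiniteDimensional k V := Module.Finite.trans Bᵐᵒᵖ V
  obtain ⟨m, j, hj⟩ := exists_embedding k B V
  have hs := IsSES.range_mkQ hj
  have : FiniteDimensional k (D k B) := inferInstanceAs (FiniteDimensional k (Module.Dual k B))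
  have : Module.Finite Bᵐᵒᵖ (Fin m → D k B) := Module.Finite.of_restrictScalars_finite k _ _
  obtain ⟨h₁, hh₁⟩ := (hX ((Fin m → D k B) ⧸ LinearMap.range j)).perp.extends
    (hs.tens_left (k := k) (A := A) X) g
  obtain ⟨h₂, hh₂⟩ := extends_tens_iff.2 (hι.coindB (Fin m)) h₁
  exact ⟨h₂ ∘ₗ Tens.mapLeft k A P j, fun z => by
    rw [LinearMap.comp_apply, Tens.mapLeft_map, hh₂, hh₁]⟩

/-- A left approximation of `V ⊗_B X` is injective, because `V ⊗_B X` embeds into a projective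
module and the embedding factors through the approximation. -/
lemma tens_injective [FiniteDimensional k B] {X P : Type u} [AddCommGroup X]
    [Module (A ⊗[k] B) X] [AddCommGroup P] [Module (A ⊗[k] B) P]
    [Module.Projective B (Res (inclB k A B) X)]
    (hX : ∀ (V : Type u) [AddCommGroup V] [Module k V] [Module Bᵐᵒᵖ V] [IsScalarTower k Bᵐᵒᵖ V]
      [Module.Finite Bᵐᵒᵖ V], Gproj A (ModuleCat.of A (Tens k A B V X)))
    {ι : X →ₗ[A ⊗[k] B] P} (hι : Extends ι (A ⊗[k] B)) (V : Type u) [AddCommGroup V] [Module k V]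
    [Module Bᵐᵒᵖ V] [IsScalarTower k Bᵐᵒᵖ V] [Module.Finite Bᵐᵒᵖ V] :
    Function.Injective (Tens.map k A B V ι) := by
  obtain ⟨_, -, Q, κ, _, ⟨hQ, hQ'⟩, hs, -⟩ := (hX V).exists_right
  obtain ⟨h, hh⟩ := (extends_tens hX hι V).of_projective Q κ
  exact fun y z hyz => hs.inj (by rw [← hh, ← hh, hyz])

/-- The modules in the monomorphism category of the Gorenstein projective `A`-modules are Gorenstein
projective over `A ⊗ B`. -/
theorem monIn_le_gproj [FiniteDimensional k A] [FiniteDimensional k B] :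
    MonIn k A B (Gproj A) ≤ Gproj (A ⊗[k] B) := fun X hX => by
  have : IsNoetherianRing A := IsNoetherianRing.of_finite k A
  have : IsNoetherianRing (A ⊗[k] B) := IsNoetherianRing.of_finite k _
  have : FiniteDimensional k (D k B) := inferInstanceAs (FiniteDimensional k (Module.Dual k B))
  have : Module.Finite Bᵐᵒᵖ (D k B) := Module.Finite.of_restrictScalars_finite k _ _
  have htens : ∀ (V : Type u) [AddCommGroup V] [Module k V] [Module Bᵐᵒᵖ V] [IsScalarTower k Bᵐᵒᵖ V]
      [Module.Finite Bᵐᵒᵖ V] (P : ModuleCat.{u} (A ⊗[k] B)), Proj (A ⊗[k] B) P →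
      Proj A (ModuleCat.of A (Tens k A B V P)) := fun V _ _ _ _ _ P ⟨hP, hP'⟩ =>
    have : FiniteDimensional k V := Module.Finite.trans Bᵐᵒᵖ V
    ⟨Tens.finite, Tens.projective⟩
  refine gproj_of_class (fun X => Module.Finite (A ⊗[k] B) X ∧
    Module.Projective B (Res (inclB k A B) X) ∧ ∀ (V : Type u) [AddCommGroup V] [Module k V]
      [Module Bᵐᵒᵖ V] [IsScalarTower k Bᵐᵒᵖ V] [Module.Finite Bᵐᵒᵖ V],
      Gproj A (ModuleCat.of A (Tens k A B V X))) (fun X hX => hX.1) ?_ ?_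
    ⟨hX.1.1, ((mon_iff X).1 hX.1).2, hX.2⟩
  · rintro Y ⟨hY₁, hY₂, hY₃⟩
    obtain ⟨X, P, ι, π, hX, hP, hs⟩ := exists_presentation (Γ := A ⊗[k] B) Y
    have := hP.2
    have : Module.Projective B (Res (inclB k A B) P) :=
      Res.projective (inclB k A B) (projective_res_inclB k A B)
    refine ⟨X, ⟨hX, (hs.res (inclB k A B)).projective_kernel, fun V _ _ _ _ _ =>
      Gproj.kernel (htens V P hP) hs.tens (hY₃ V)⟩, P, ι, π, hP, hs, ?_⟩
    exact (extends_tens_iff.1 ((hY₃ (D k B)).perp.extends hs.tens)).of_coindB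
  · rintro X ⟨hX₁, hX₂, hX₃⟩
    obtain ⟨n, ι, hι⟩ := exists_extends_pi (k := k) (Γ := A ⊗[k] B) X
    have hP : Proj (A ⊗[k] B) (ModuleCat.of _ (Fin n → A ⊗[k] B)) :=
      ⟨inferInstanceAs (Module.Finite (A ⊗[k] B) (Fin n → A ⊗[k] B)),
        inferInstanceAs (Module.Projective (A ⊗[k] B) (Fin n → A ⊗[k] B))⟩
    have : Module.Projective B (Res (inclB k A B) (Fin n → A ⊗[k] B)) :=
      Res.projective (inclB k A B) (projective_res_inclB k A B)
    -- the approximation is a split injection over `B`, because it stays injective under `DX ⊗_B -`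
    have : Module.Finite B (Res (inclB k A B) X) :=
      Res.finite (inclB k A B) (X := X) (finite_res_inclB k A B)
    let := Module.compHom (Res (inclB k A B) X) (algebraMap k B)
    have : IsScalarTower k B (Res (inclB k A B) X) :=
      ⟨fun c b s => by rw [Algebra.smul_def, mul_smul]; rfl⟩
    have : FiniteDimensional k (Res (inclB k A B) X) := Module.Finite.trans B _
    have : FiniteDimensional k (D k (Res (inclB k A B) X)) :=
      inferInstanceAs (FiniteDimensional k (Module.Dual k (Res (inclB k A B) X)))
    have : Module.Finite Bᵐᵒᵖ (D k (Res (inclB k A B) X)) :=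
      Module.Finite.of_restrictScalars_finite k _ _
    have hret : Extends (Res.map (inclB k A B) ι) (Res (inclB k A B) X) :=
      extends_res_of_tens_injective _ (tens_injective hX₃ hι _)
    have hinj : Function.Injective ι := fun x y hxy => by
      obtain ⟨r, hr⟩ := hret LinearMap.id
      have := (hr (toRes _ X x)).symm.trans ((congrArg r hxy).trans (hr (toRes _ X y)))
      exact this
    have hs := IsSES.range_mkQ hinj
    have hC : Module.Projective B (Res (inclB k A B) ((Fin n → A ⊗[k] B) ⧸ LinearMap.range ι)) :=
      (hs.res (inclB k A B)).projective_of_extends hret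
    refine ⟨ModuleCat.of _ ((Fin n → A ⊗[k] B) ⧸ LinearMap.range ι),
      ⟨inferInstanceAs (Module.Finite _ ((Fin n → A ⊗[k] B) ⧸ LinearMap.range ι)), hC,
        fun V _ _ _ _ _ => ?_⟩, _, ι, _, hP, hs, hι⟩
    exact Gproj.cokernel (X := ModuleCat.of A (Tens k A B V X)) (htens V _ hP) hs.tens
      (extends_tens hX₃ hι V) (hX₃ V)

end MonGproj

/-! ### Induction of modules from `B` to `A ⊗ B` -/

section Induction

variable (k A B : Type u) [Field k] [Ring A] [Algebra k A] [Ring B] [Algebra k B]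
variable (G H K : Type u) [AddCommGroup G] [Module B G] [AddCommGroup H] [Module B H]
  [AddCommGroup K] [Module B K]

/-- The action of `B` on a left `B`-module `G`, by `k`-linear endomorphisms. -/
def actionB : B →ₐ[k] Module.End k (Res (algebraMap k B) G) where
  toFun b :=
    { toFun := fun g => toRes _ G (b • (toRes _ G).symm g)
      map_add' := fun g h => by simp
      map_smul' := fun c g => by
        change b • algebraMap k B c • (toRes _ G).symm g =
          algebraMap k B c • b • (toRes _ G).symm g
        rw [smul_smul, smul_smul, Algebra.commutes] }
  map_one' := LinearMap.ext fun g => one_smul B ((toRes _ G).symm g)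
  map_mul' b c := LinearMap.ext fun g => mul_smul b c ((toRes _ G).symm g)
  map_zero' := LinearMap.ext fun g => zero_smul B ((toRes _ G).symm g)
  map_add' b c := LinearMap.ext fun g => add_smul b c ((toRes _ G).symm g)
  commutes' _ := rfl

/-- The left `A ⊗ B`-module `A ⊗ G`, for a left `B`-module `G`. -/
def Ind : Type u := A ⊗[k] Res (algebraMap k B) G

instance : AddCommGroup (Ind k A B G) :=
  inferInstanceAs (AddCommGroup (A ⊗[k] Res (algebraMap k B) G))

/-- The element `a ⊗ g` of `A ⊗ G`. -/
def Ind.tmul (a : A) (g : G) : Ind k A B G := a ⊗ₜ[k] toRes (algebraMap k B) G g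

/-- The action of `A ⊗ B` on `A ⊗ G`: `(a ⊗ b) (a' ⊗ g) = a a' ⊗ b g`. -/
noncomputable def leftAction : A ⊗[k] B →ₐ[k] Module.End k (A ⊗[k] Res (algebraMap k B) G) :=
  (Module.endTensorEndAlgHom (R := k) (S := k) (A := k) (M := A)
    (N := Res (algebraMap k B) G)).comp
    (Algebra.TensorProduct.map (Algebra.lsmul k k A : A →ₐ[k] Module.End k A) (actionB k B G))

noncomputable instance : Module (A ⊗[k] B) (Ind k A B G) :=
  Module.compHom (A ⊗[k] Res (algebraMap k B) G) (leftAction k A B G).toRingHom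

variable {k A B G H K}

namespace Ind

lemma smul_tmul (a a' : A) (b : B) (g : G) :
    (a ⊗ₜ[k] b) • tmul k A B G a' g = tmul k A B G (a * a') (b • g) := by
  change leftAction k A B G (a ⊗ₜ[k] b) (a' ⊗ₜ[k] toRes (algebraMap k B) G g) = _
  simp only [leftAction, AlgHom.comp_apply, Algebra.TensorProduct.map_tmul]
  rfl

lemma tmul_eq_smul (a : A) (g : G) :
    tmul k A B G a g = (a ⊗ₜ[k] (1 : B)) • tmul k A B G 1 g := by
  rw [smul_tmul, mul_one, one_smul]

@[elab_as_elim]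
lemma induction {p : Ind k A B G → Prop} (z : Ind k A B G) (zero : p 0)
    (add : ∀ y z, p y → p z → p (y + z)) (tmul : ∀ a g, p (tmul k A B G a g)) : p z :=
  TensorProduct.induction_on (motive := p) z zero tmul add

/-- The unit `g ↦ 1 ⊗ g` of the adjunction between induction and restriction. -/
def unit : G →ₗ[B] Res (inclB k A B) (Ind k A B G) where
  toFun g := toRes _ (Ind k A B G) (tmul k A B G 1 g)
  map_add' g h := TensorProduct.tmul_add _ _ _
  map_smul' b g := by
    change tmul k A B G 1 (b • g) = ((1 : A) ⊗ₜ[k] b) • tmul k A B G 1 g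
    rw [smul_tmul, mul_one]

lemma hom_ext {N : Type u} [AddCommGroup N] [Module (A ⊗[k] B) N]
    {f f' : Ind k A B G →ₗ[A ⊗[k] B] N}
    (h : ∀ g, f (tmul k A B G 1 g) = f' (tmul k A B G 1 g)) : f = f' :=
  LinearMap.ext fun z => by
    induction z using induction with
    | zero => rw [map_zero, map_zero]
    | add y z hy hz => rw [map_add, map_add, hy, hz]
    | tmul a g => rw [tmul_eq_smul, map_smul, map_smul, h]

/-- Induction is left adjoint to restriction along `B → A ⊗ B`. -/
lemma exists_hom {N : Type u} [AddCommGroup N] [Module (A ⊗[k] B) N]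
    (f : G →ₗ[B] Res (inclB k A B) N) : ∃ f' : Ind k A B G →ₗ[A ⊗[k] B] N,
      ∀ g, f' (tmul k A B G 1 g) = (toRes _ N).symm (f g) := by
  have hf : ∀ (b : B) g, (toRes _ N).symm (f (b • g)) =
      ((1 : A) ⊗ₜ[k] b) • (toRes _ N).symm (f g) := fun b g => by rw [map_smul]; rfl
  let F : Ind k A B G →+ N := TensorProduct.liftAddHom (R := k) (M := A)
    (N := Res (algebraMap k B) G)
    { toFun := fun a => AddMonoidHom.mk'
        (fun g => (a ⊗ₜ[k] (1 : B)) • (toRes _ N).symm (f ((toRes _ G).symm g)))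
        (fun g h => by rw [map_add, map_add, map_add, smul_add])
      map_zero' := by ext; simp
      map_add' := fun a b => by ext; simp [TensorProduct.add_tmul, add_smul] }
    (fun c a g => by
      change ((c • a) ⊗ₜ[k] (1 : B)) • (toRes _ N).symm (f ((toRes _ G).symm g)) =
        (a ⊗ₜ[k] (1 : B)) • (toRes _ N).symm (f (algebraMap k B c • (toRes _ G).symm g))
      rw [hf, smul_smul, Algebra.TensorProduct.tmul_mul_tmul, one_mul, mul_one,
        Algebra.algebraMap_eq_smul_one, TensorProduct.smul_tmul])
  have hF : ∀ a g, F (tmul k A B G a g) = (a ⊗ₜ[k] (1 : B)) • (toRes _ N).symm (f g) :=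
    fun a g => rfl
  refine ⟨linearOfTmul F fun a b z => ?_, fun g => ?_⟩
  · induction z using induction with
    | zero => simp
    | add y z hy hz => rw [smul_add, map_add, hy, hz, map_add, smul_add]
    | tmul a' g =>
      rw [smul_tmul, hF, hF, hf, smul_smul, smul_smul, Algebra.TensorProduct.tmul_mul_tmul,
        Algebra.TensorProduct.tmul_mul_tmul, mul_one, mul_one, one_mul]
  · refine (hF 1 g).trans ?_
    rw [← Algebra.TensorProduct.one_def, one_smul]

variable (k A) in
/-- The map `A ⊗ G → A ⊗ H` induced by a `B`-linear map `G → H`. -/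
noncomputable def map (f : G →ₗ[B] H) : Ind k A B G →ₗ[A ⊗[k] B] Ind k A B H :=
  let F : Ind k A B G →+ Ind k A B H :=
    (LinearMap.lTensor A (Res.map (algebraMap k B) f)).toAddMonoidHom
  have hF : ∀ a g, F (tmul k A B G a g) = tmul k A B H a (f g) := fun _ _ => rfl
  linearOfTmul F fun a b z => by
    induction z using induction with
    | zero => simp
    | add y z hy hz => rw [smul_add, map_add, hy, hz, map_add, smul_add]
    | tmul a' g => rw [smul_tmul, hF, hF, smul_tmul, map_smul]

lemma map_tmul (f : G →ₗ[B] H) (a : A) (g : G) :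
    map k A f (tmul k A B G a g) = tmul k A B H a (f g) := rfl

end Ind

lemma IsSES.ind {ι : G →ₗ[B] H} {π : H →ₗ[B] K} (h : IsSES ι π) :
    IsSES (Ind.map k A ι) (Ind.map k A π) :=
  ⟨Module.Flat.lTensor_preserves_injective_linearMap (M := A) _ (h.res (algebraMap k B)).inj,
    lTensor_exact A (h.res (algebraMap k B)).exact (h.res (algebraMap k B)).surj,
    LinearMap.lTensor_surjective A (h.res (algebraMap k B)).surj⟩

lemma Ind.projective [Module.Projective B G] : Module.Projective (A ⊗[k] B) (Ind k A B G) := by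
  refine Module.Projective.of_lifting_property'' fun p hp => ?_
  obtain ⟨s, hs⟩ := exists_lift_of_projective (p := Res.map (inclB k A B) p) hp
    (Ind.unit (k := k) (A := A) (G := G))
  obtain ⟨s', hs'⟩ := Ind.exists_hom s
  exact ⟨s', Ind.hom_ext fun g => by
    rw [LinearMap.comp_apply, hs']
    exact hs g⟩

lemma Ind.finite [Module.Finite B G] : Module.Finite (A ⊗[k] B) (Ind k A B G) := by
  obtain ⟨n, f, hf⟩ := Module.Finite.exists_fin' B G
  let F : (Fin n → A ⊗[k] B) →ₗ[A ⊗[k] B] Ind k A B G :=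
    Fintype.linearCombination (A ⊗[k] B) fun i => Ind.tmul k A B G 1 (f (Pi.single i 1))
  refine Module.Finite.of_surjective F (LinearMap.range_eq_top.1 (eq_top_iff.2 fun z _ => ?_))
  have h1 : ∀ g : Fin n → B, Ind.tmul k A B G 1 (f g) ∈ LinearMap.range F := fun g => by
    refine ⟨fun i => (1 : A) ⊗ₜ[k] g i, ?_⟩
    simp only [F, Fintype.linearCombination_apply, Ind.smul_tmul, mul_one, ← map_smul]
    refine (map_sum (Ind.unit (k := k) (A := A) (B := B) (G := G)) _ _).symm.trans ?_
    refine congrArg (Ind.tmul k A B G 1) ?_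
    rw [← map_sum]
    exact congrArg f (by ext i; simp [Finset.sum_apply, Pi.single_apply])
  induction z using Ind.induction with
  | zero => exact zero_mem _
  | add y z hy hz => exact add_mem (hy trivial) (hz trivial)
  | tmul a g =>
    obtain ⟨g, rfl⟩ := hf g
    rw [Ind.tmul_eq_smul]
    exact Submodule.smul_mem _ _ (h1 g)

/-- As `A ⊗ B` is finitely generated projective over `B`, maps to it extend along `A ⊗ ι`. -/
lemma Extends.ind [FiniteDimensional k A] {ι : G →ₗ[B] H} (h : Extends ι B) :
    Extends (Ind.map k A ι) (A ⊗[k] B) := fun f => by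
  have := finite_res_inclB k A B
  have := projective_res_inclB k A B
  obtain ⟨e, he⟩ := h.of_projective (Res (inclB k A B) (A ⊗[k] B))
    (Res.map (inclB k A B) f ∘ₗ Ind.unit)
  obtain ⟨f', hf'⟩ := Ind.exists_hom e
  refine ⟨f', fun x => LinearMap.congr_fun (f := f' ∘ₗ Ind.map k A ι) (Ind.hom_ext fun g => ?_) x⟩
  rw [LinearMap.comp_apply, Ind.map_tmul, hf', he]
  rfl

/-- Induction preserves Gorenstein projective modules. -/
theorem gproj_ind [FiniteDimensional k A] {G : ModuleCat.{u} B} (hG : Gproj B G) :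
    Gproj (A ⊗[k] B) (ModuleCat.of _ (Ind k A B G)) := by
  have hstep : ∀ X Y : ModuleCat.{u} B, Step X Y →
      Step (ModuleCat.of (A ⊗[k] B) (Ind k A B X)) (ModuleCat.of _ (Ind k A B Y)) := by
    rintro X Y ⟨P, ι, π, ⟨hP, hP'⟩, hs, he⟩
    exact ⟨ModuleCat.of _ (Ind k A B P), Ind.map k A ι, Ind.map k A π,
      ⟨Ind.finite, Ind.projective⟩, hs.ind, he.ind⟩
  refine gproj_of_class (fun Z => ∃ X : ModuleCat.{u} B, Gproj B X ∧
    Z = ModuleCat.of _ (Ind k A B X)) ?_ ?_ ?_ ⟨G, hG, rfl⟩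
  · rintro _ ⟨X, hX, rfl⟩
    have := hX.finite
    exact Ind.finite (G := X)
  · rintro _ ⟨X, hX, rfl⟩
    obtain ⟨Y, hY, h⟩ := hX.exists_left
    exact ⟨_, ⟨Y, hY, rfl⟩, hstep _ _ h⟩
  · rintro _ ⟨X, hX, rfl⟩
    obtain ⟨Y, hY, h⟩ := hX.exists_right
    exact ⟨_, ⟨Y, hY, rfl⟩, hstep _ _ h⟩

/-- If `A ≠ 0`, then `G` is a direct summand of the `B`-module `A ⊗ G`. -/
lemma projective_of_ind [Nontrivial A]
    (h : Module.Projective B (Res (inclB k A B) (Ind k A B G))) : Module.Projective B G := by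
  obtain ⟨ε, hε⟩ := (Algebra.linearMap k A).exists_leftInverse_of_injective
    (LinearMap.ker_eq_bot.2 (algebraMap k A).injective)
  -- the map `a ⊗ g ↦ ε a • g`
  let ρ : Ind k A B G →+ G := (toRes (algebraMap k B) G).symm.toAddMonoidHom.comp
    ((TensorProduct.lid k _).toLinearMap ∘ₗ LinearMap.rTensor _ ε).toAddMonoidHom
  have hρ : ∀ a g, ρ (Ind.tmul k A B G a g) = algebraMap k B (ε a) • g := fun _ _ => rfl
  have hsmul : ∀ (b : B) z, ρ (((1 : A) ⊗ₜ[k] b) • z) = b • ρ z := fun b z => by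
    induction z using Ind.induction with
    | zero => simp
    | add y z hy hz => rw [smul_add, map_add, hy, hz, map_add, smul_add]
    | tmul a g =>
      rw [Ind.smul_tmul, hρ, hρ, one_mul, smul_smul, smul_smul, Algebra.commutes]
  let r : Res (inclB k A B) (Ind k A B G) →ₗ[B] G :=
    { toFun := fun z => ρ ((toRes _ (Ind k A B G)).symm z)
      map_add' := fun y z => by rw [map_add, map_add]
      map_smul' := fun b z => hsmul b ((toRes _ (Ind k A B G)).symm z) }
  refine Module.Projective.of_split (Ind.unit (k := k) (A := A)) r (LinearMap.ext fun g => ?_)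
  change ρ (Ind.tmul k A B G 1 g) = g
  have h1 : ε 1 = 1 := by simpa using LinearMap.congr_fun hε 1
  rw [hρ, h1, map_one, one_smul]

/-- If all Gorenstein projective `A ⊗ B`-modules are projective over `B`, then `B` is CM-free. -/
theorem isCMFree_of_gproj_le_mon [FiniteDimensional k A] [FiniteDimensional k B] [Nontrivial A]
    (h : Gproj (A ⊗[k] B) ≤ Mon k A B) : IsCMFree B :=
  le_antisymm (fun _ hG => ⟨hG.finite,
    projective_of_ind ((mon_iff _).1 (h _ (gproj_ind (k := k) (A := A) hG))).2⟩) proj_le_gproj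

end Induction

end MonGorenstein

theorem mainTheorem1 (k A B : Type u) [Field k] [Ring A] [Algebra k A] [Ring B] [Algebra k B]
    [FiniteDimensional k A] [FiniteDimensional k B] [Nontrivial A]
    (hA : MonGorenstein.IsGorenstein A) :
    MonGorenstein.Gproj (A ⊗[k] B) = MonGorenstein.MonIn k A B (MonGorenstein.Gproj A) ↔
      MonGorenstein.IsCMFree B :=
  ⟨fun h => MonGorenstein.isCMFree_of_gproj_le_mon fun X hX => (h.le X hX).1,
    fun hB => le_antisymm (MonGorenstein.gproj_le_monIn hA hB) MonGorenstein.monIn_le_gproj⟩
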